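/- **Graphs and terms.** Fix a finite alphabet $\Sigma$. A graph is a finite vertex set with a multiset of $\Sigma$-labelled directed edges and two distinct vertices, the source and the target; isomorphic graphs are identified. The serial composition $G_1\circ G_2$ glues the target of $G_1$ to the source of $G_2$; the parallel composition $G_1\parallel G_2$ glues sources together and targets together; the $a$-bridge is a single $a$-labelled edge from source to target. SP-graphs are the closure of the bridges under $\circ$ and $\parallel$. An SP-graph is a P-graph if it is not a bridge and not of the form $G_1\circ G_2$; otherwise it is an S-graph. A ground term over $\circ,\parallel,\Sigma$ evaluates to an SP-graph. **Regular grammars.** A regular grammar $\Gamma$ has a finite set $\mathcal P\uplus\mathcal S$ of nonterminals, a finite set of rules, and a set of axioms. Its rules have the forms (A) $p\to p\parallel s^{\ell}$ with $\ell\ge 1$; (B) $p\to s_1^{\ell_1}\parallel\dots\parallel s_k^{\ell_k}$ with $k,\ell_i\ge 1$, $\sum_i\ell_i\ge 2$; (C) $s\to p\circ s_1$; (D) $s\to p_1\circ p_2$; (E) $p\to a$; (F) $s\to a$, where $p,p_i\in\mathcal P$, $s,s_i\in\mathcal S$, $a\in\Sigma$, and $s^\ell$ abbreviates the $\ell$-fold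 parallel composition of $s$. Its size is $|\Gamma|=\sum_{x\to t}(2+|t|)$, the sum being over all rules $x\to t$, where $|t|$ is the number of symbol occurrences in the term $t$. **Preparation.** First, each rule $r: p\to p\parallel s^\ell$ of form (A) is replaced by $p\to p\parallel s_r^\ell$ with a fresh $\mathcal S$-nonterminal $s_r$, and a rule $s_r\to t$ is added for each rule $s\to t$. Second, each rule $p\to a$ of form (E) is replaced by $p\to s_a$ and $s_a\to a$, with a fresh $\mathcal S$-nonterminal $s_a$, which is an axiom if such a $p$ is one. In what follows $\mathcal S$, and derivations $\to^*$, refer to the resulting grammar. For $p\in\mathcal P$, a nonterminal $s\in\mathcal S$ is periodic with period $\ell$ if there is a rule $p\to p\parallel s^\ell$; it is bounded if it occurs in a rule $p\to s_1^{\ell_1}\parallel\dots\parallel s_k^{\ell_k}$ (including $p\to s_a$), and its bound is one plus the largest multiplicity of $s$ in such rules. **Profiles.** The $p$-normal form of a set (formal idempotent sum) of commutative monomials over the bounded and periodic nonterminals of $p$ is obtained by deleting the monomials in which some bounded $s$ has degree at least its bound, and reducing the degree of each periodic $s$ modulo its period. The profile $h(G)$ of a P-graph $G$ is the tuple, indexed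 by $p\in\mathcal P$, of the $p$-normal forms of the sets of all such monomials $s_1\cdots s_n$ for which there are ground terms $t_i$ with $s_i\to^* t_i$ and $G=t_1\parallel\dots\parallel t_n$. The profile $h(G)$ of an S-graph $G$ is the set of pairs $(s,q)\in\mathcal S\times(\mathcal P\uplus\mathcal S\uplus\{\bot\})$ for which there is a ground term $t$ with value $G$ such that, up to associativity of $\circ$, $s\to^* t\circ q$ (if $q\ne\bot$) or $s\to^* t$ (if $q=\bot$). The domain of the recognizer algebra $\mathcal A$ built from $\Gamma$ is $\{h(G)\mid G \text{ an SP-graph}\}$, P-profiles and S-profiles being distinct. **Theorem.** The recognizer algebra built from a regular grammar $\Gamma$ has $2^{\mathcal O(|\Gamma|^9)}$ elements: there is an absolute constant $C$ such that, for every finite alphabet $\Sigma$ and every regular grammar $\Gamma$ over $\Sigma$ with at least one rule, the domain of $\mathcal A$ is finite and has at most $2^{C|\Gamma|^9}$ elements. -/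

import Mathlib

namespace SP

universe u v w

/-! ### Graphs with a source and a target -/

/-- A finite graph with a multiset of labelled directed edges and two distinct designated
vertices, the source and the target. Graphs are identified up to `Graph.Iso`. -/
structure Graph (L : Type u) where
  V : Type
  finite_V : Finite V
  edges : Multiset (V × L × V)
  source : V
  target : V
  source_ne_target : source ≠ target

namespace Graph

variable {L : Type u}

/-- Isomorphism: `G` and `H` differ only by a renaming of the vertices. -/
def Iso (G H : Graph L) : Prop :=
  ∃ e : G.V ≃ H.V, e G.source = H.source ∧ e G.target = H.target ∧
    G.edges.map (fun x => (e x.1, x.2.1, e x.2.2)) = H.edges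

/-- The `a`-bridge: two vertices and a single `a`-labelled edge from source to target. -/
def bridge (a : L) : Graph L where
  V := Bool
  finite_V := inferInstance
  edges := {(false, a, true)}
  source := false
  target := true
  source_ne_target := by decide

open Classical in
/-- How the vertices of `H` sit in `G ∘ H`: the source of `H` becomes the target of `G`. -/
noncomputable def serialEmb (G H : Graph L) (v : H.V) : G.V ⊕ {v : H.V // v ≠ H.source} :=
  if h : v = H.source then Sum.inl G.target else Sum.inr ⟨v, h⟩

/-- Serial composition `G ∘ H`. -/
noncomputable def serial (G H : Graph L) : Graph L where
  V := G.V ⊕ {v : H.V // v ≠ H.source}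
  finite_V := by
    have := G.finite_V
    have := H.finite_V
    infer_instance
  edges := G.edges.map (fun x => (Sum.inl x.1, x.2.1, Sum.inl x.2.2)) +
    H.edges.map (fun x => (serialEmb G H x.1, x.2.1, serialEmb G H x.2.2))
  source := Sum.inl G.source
  target := Sum.inr ⟨H.target, H.source_ne_target.symm⟩
  source_ne_target := by simp

open Classical in
/-- How the vertices of `H` sit in `G ∥ H`: source and target are those of `G`. -/
noncomputable def parallelEmb (G H : Graph L) (v : H.V) :
    G.V ⊕ {v : H.V // v ≠ H.source ∧ v ≠ H.target} :=
  if h : v = H.source then Sum.inl G.source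
  else if h' : v = H.target then Sum.inl G.target
  else Sum.inr ⟨v, h, h'⟩

/-- Parallel composition `G ∥ H`. -/
noncomputable def parallel (G H : Graph L) : Graph L where
  V := G.V ⊕ {v : H.V // v ≠ H.source ∧ v ≠ H.target}
  finite_V := by
    have := G.finite_V
    have := H.finite_V
    infer_instance
  edges := G.edges.map (fun x => (Sum.inl x.1, x.2.1, Sum.inl x.2.2)) +
    H.edges.map (fun x => (parallelEmb G H x.1, x.2.1, parallelEmb G H x.2.2))
  source := Sum.inl G.source
  target := Sum.inl G.target
  source_ne_target := fun h => G.source_ne_target (Sum.inl.inj h)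

/-- Series-parallel graphs: the closure of the bridges under the two compositions
(up to isomorphism). -/
inductive IsSP : Graph L → Prop
  | bridge (a : L) : IsSP (bridge a)
  | serial {G H : Graph L} : IsSP G → IsSP H → IsSP (serial G H)
  | parallel {G H : Graph L} : IsSP G → IsSP H → IsSP (parallel G H)
  | iso {G H : Graph L} : IsSP G → Iso G H → IsSP H

def IsAtomic (G : Graph L) : Prop := ¬ ∃ G₁ G₂ : Graph L, Iso G (serial G₁ G₂)

def IsBridge (G : Graph L) : Prop := ∃ a : L, Iso G (bridge a)

/-- Among the SP-graphs, the P-graphs are the atomic ones that are not bridges; all the others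
(the bridges and the non-atomic graphs) are the S-graphs. -/
def IsPGraph (G : Graph L) : Prop := IsAtomic G ∧ ¬ IsBridge G

end Graph

/-! ### Terms and grammars -/

/-- Terms over the signature `{∘, ∥} ⊎ L`, with variables (nonterminals) from `N`. -/
inductive Term (L : Type u) (N : Type v) : Type (max u v)
  | sym (a : L) : Term L N
  | var (x : N) : Term L N
  | ser (t₁ t₂ : Term L N) : Term L N
  | par (t₁ t₂ : Term L N) : Term L N

namespace Term

variable {L : Type u} {N : Type v} {M : Type w}

/-- The length of a term as a string of symbols. -/
def size : Term L N → ℕ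
  | sym _ => 1
  | var _ => 1
  | ser t₁ t₂ => t₁.size + t₂.size + 1
  | par t₁ t₂ => t₁.size + t₂.size + 1

/-- Renaming of the variables. -/
def map (f : N → M) : Term L N → Term L M
  | sym a => sym a
  | var x => var (f x)
  | ser t₁ t₂ => ser (t₁.map f) (t₂.map f)
  | par t₁ t₂ => par (t₁.map f) (t₂.map f)

/-- A ground term, seen as a term with variables from `N`. -/
def lift (t : Term L Empty) : Term L N := t.map Empty.elim

/-- The value of a ground term in the algebra of SP-graphs. -/
noncomputable def eval : Term L Empty → Graph L
  | sym a => Graph.bridge a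
  | var x => x.elim
  | ser t₁ t₂ => Graph.serial t₁.eval t₂.eval
  | par t₁ t₂ => Graph.parallel t₁.eval t₂.eval

/-- `IsPar t m`: the term `t` is the parallel composition, in some order and bracketing, of the
variables in the nonempty multiset `m`. -/
inductive IsPar : Term L N → Multiset N → Prop
  | var (x : N) : IsPar (var x) {x}
  | par {t₁ t₂ : Term L N} {m₁ m₂ : Multiset N} :
      IsPar t₁ m₁ → IsPar t₂ m₂ → IsPar (par t₁ t₂) (m₁ + m₂)

/-- `t` can be rewritten into `u` by the associativity law of `∘`. -/
inductive AssocEq : Term L N → Term L N → Prop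
  | assoc (t₁ t₂ t₃ : Term L N) : AssocEq (ser (ser t₁ t₂) t₃) (ser t₁ (ser t₂ t₃))
  | refl (t : Term L N) : AssocEq t t
  | symm {t u : Term L N} : AssocEq t u → AssocEq u t
  | trans {t u v : Term L N} : AssocEq t u → AssocEq u v → AssocEq t v
  | ser {t t' u u' : Term L N} : AssocEq t t' → AssocEq u u' → AssocEq (ser t u) (ser t' u')
  | par {t t' u u' : Term L N} : AssocEq t t' → AssocEq u u' → AssocEq (par t u) (par t' u')

end Term

/-- A grammar with nonterminals `N`: a finite set of rules `x → t`, and a set of axioms. -/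
structure Grammar (L : Type u) (N : Type v) where
  rules : Set (N × Term L N)
  finite_rules : rules.Finite
  axs : Set N

namespace Grammar

variable {L : Type u} {N : Type v}

/-- The length of the grammar as a string: `∑ (2 + |t|)` over the rules `x → t`. -/
noncomputable def size (Γ : Grammar L N) : ℕ :=
  ∑ r ∈ Γ.finite_rules.toFinset, (2 + r.2.size)

/-- A derivation step: one occurrence of a nonterminal is replaced, according to a rule. -/
inductive Step (Γ : Grammar L N) : Term L N → Term L N → Prop
  | rule {x : N} {t : Term L N} : (x, t) ∈ Γ.rules → Step Γ (Term.var x) t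
  | serL {t t' : Term L N} (u : Term L N) : Step Γ t t' → Step Γ (Term.ser t u) (Term.ser t' u)
  | serR {t t' : Term L N} (u : Term L N) : Step Γ t t' → Step Γ (Term.ser u t) (Term.ser u t')
  | parL {t t' : Term L N} (u : Term L N) : Step Γ t t' → Step Γ (Term.par t u) (Term.par t' u)
  | parR {t t' : Term L N} (u : Term L N) : Step Γ t t' → Step Γ (Term.par u t) (Term.par u t')

def Derives (Γ : Grammar L N) : Term L N → Term L N → Prop := Relation.ReflTransGen Γ.Step

/-- Derivation followed by associativity of `∘`. -/
def DerivesAssoc (Γ : Grammar L N) (t u : Term L N) : Prop :=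
  ∃ w, Γ.Derives t w ∧ Term.AssocEq w u

end Grammar

/-! ### Regular grammars

The nonterminals are `P ⊕ S`. -/

section Rules

variable {L : Type u} {P : Type v} {S : Type w}

/-- (A) `p → p ∥ s^ℓ` with `ℓ ≥ 1`. -/
def FormA (r : (P ⊕ S) × Term L (P ⊕ S)) (p : P) (s : S) (ℓ : ℕ) : Prop :=
  r.1 = Sum.inl p ∧ 1 ≤ ℓ ∧ r.2.IsPar (Sum.inl p ::ₘ Multiset.replicate ℓ (Sum.inr s))

/-- `p → s₁^ℓ₁ ∥ … ∥ s_k^ℓ_k`, where the right-hand side contains the nonterminals `m`, counted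
with multiplicity. In a regular grammar `m` has at least two elements. -/
def FormB (r : (P ⊕ S) × Term L (P ⊕ S)) (p : P) (m : Multiset S) : Prop :=
  r.1 = Sum.inl p ∧ r.2.IsPar (m.map Sum.inr)

/-- Regular rules. -/
inductive RegularRule : (P ⊕ S) × Term L (P ⊕ S) → Prop
  | A {r : (P ⊕ S) × Term L (P ⊕ S)} {p : P} {s : S} {ℓ : ℕ} : FormA r p s ℓ → RegularRule r
  | B {r : (P ⊕ S) × Term L (P ⊕ S)} {p : P} {m : Multiset S} :
      FormB r p m → 2 ≤ Multiset.card m → RegularRule r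
  | C (s : S) (p : P) (s₁ : S) :
      RegularRule (Sum.inr s, Term.ser (Term.var (Sum.inl p)) (Term.var (Sum.inr s₁)))
  | D (s : S) (p₁ p₂ : P) :
      RegularRule (Sum.inr s, Term.ser (Term.var (Sum.inl p₁)) (Term.var (Sum.inl p₂)))
  | E (p : P) (a : L) : RegularRule (Sum.inl p, Term.sym a)
  | F (s : S) (a : L) : RegularRule (Sum.inr s, Term.sym a)

end Rules

namespace Grammar

variable {L : Type u} {P : Type v} {S : Type w}

def IsRegular (Γ : Grammar L (P ⊕ S)) : Prop := ∀ r ∈ Γ.rules, RegularRule r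

/-- The rules of the form (A). -/
def RulesA (Γ : Grammar L (P ⊕ S)) : Set ((P ⊕ S) × Term L (P ⊕ S)) :=
  {r | r ∈ Γ.rules ∧ ∃ p s ℓ, FormA r p s ℓ}

/-- The labels `a` for which there is a rule `p → a` with `p` in `P`. -/
def LabelsE (Γ : Grammar L (P ⊕ S)) : Set L :=
  {a | ∃ p : P, ((Sum.inl p : P ⊕ S), (Term.sym a : Term L (P ⊕ S))) ∈ Γ.rules}

/-- An old nonterminal among the new ones, of which there are more in the second part. -/
def old {T : Type*} : P ⊕ S → P ⊕ (S ⊕ T) := Sum.map id Sum.inl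

/-- The normal form of a regular grammar. Each rule `r : p → p ∥ s^ℓ` is replaced by
`p → p ∥ s_r^ℓ`, where `s_r` is a fresh nonterminal, which inherits the rules of `s`. -/
def normalize (Γ : Grammar L (P ⊕ S)) : Grammar L (P ⊕ (S ⊕ Γ.RulesA)) where
  rules :=
    (fun r => (old r.1, r.2.map old)) '' (Γ.rules \ Γ.RulesA) ∪
    Set.range (fun r : Γ.RulesA =>
      (old r.1.1, r.1.2.map (Sum.map id (fun _ => Sum.inr r)))) ∪
    {r' | ∃ (r : Γ.RulesA) (p : P) (s : S) (ℓ : ℕ) (t : Term L (P ⊕ S)),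
      FormA r.1 p s ℓ ∧ (Sum.inr s, t) ∈ Γ.rules ∧ r' = (Sum.inr (Sum.inr r), t.map old)}
  finite_rules := by
    have hA : Γ.RulesA.Finite := Γ.finite_rules.subset (fun r hr => hr.1)
    have := hA.to_subtype
    refine Set.Finite.union (Set.Finite.union ?_ ?_) ?_
    · exact (Γ.finite_rules.subset Set.sdiff_subset).image _
    · exact Set.finite_range _
    · have h : ((Set.univ : Set Γ.RulesA) ×ˢ Γ.rules).Finite :=
        Set.finite_univ.prod Γ.finite_rules
      refine (h.image (fun z => (Sum.inr (Sum.inr z.1), z.2.2.map old))).subset ?_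
      rintro _ ⟨r, p, s, ℓ, t, -, ht, rfl⟩
      exact ⟨(r, (Sum.inr s, t)), ⟨trivial, ht⟩, rfl⟩
  axs := old '' Γ.axs

/-- The alternative grammar: each rule `p → a` is replaced by `p → s_a` and `s_a → a`, where
`s_a` is a fresh nonterminal, which is an axiom if some such `p` is one. -/
def alternative (Γ : Grammar L (P ⊕ S)) : Grammar L (P ⊕ (S ⊕ Γ.LabelsE)) where
  rules :=
    (fun r => (old r.1, r.2.map old)) ''
      {r | r ∈ Γ.rules ∧ ¬ ∃ (p : P) (a : L), r = (Sum.inl p, Term.sym a)} ∪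
    {r' | ∃ (p : P) (a : Γ.LabelsE), (Sum.inl p, Term.sym a.1) ∈ Γ.rules ∧
      r' = (Sum.inl p, Term.var (Sum.inr (Sum.inr a)))} ∪
    Set.range (fun a : Γ.LabelsE => (Sum.inr (Sum.inr a), Term.sym a.1))
  finite_rules := by
    have hL : Γ.LabelsE.Finite := by
      refine ((Γ.finite_rules.image (fun r => r.2)).preimage
        (f := fun a : L => (Term.sym a : Term L (P ⊕ S))) ?_).subset ?_
      · intro a _ b _ hab
        exact Term.sym.inj hab
      · rintro a ⟨p, hp⟩
        exact ⟨_, hp, rfl⟩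
    have := hL.to_subtype
    refine Set.Finite.union (Set.Finite.union ?_ ?_) ?_
    · exact (Γ.finite_rules.subset (fun r hr => hr.1)).image _
    · have h : (Γ.rules ×ˢ (Set.univ : Set Γ.LabelsE)).Finite :=
        Γ.finite_rules.prod Set.finite_univ
      refine (h.image (fun z => (old z.1.1, Term.var (Sum.inr (Sum.inr z.2))))).subset ?_
      rintro _ ⟨p, a, hp, rfl⟩
      exact ⟨((Sum.inl p, Term.sym a.1), a), ⟨hp, trivial⟩, rfl⟩
    · exact Set.finite_range _
  axs := old '' Γ.axs ∪
    {x | ∃ (p : P) (a : Γ.LabelsE), Sum.inl p ∈ Γ.axs ∧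
      (Sum.inl p, Term.sym a.1) ∈ Γ.rules ∧ x = Sum.inr (Sum.inr a)}

/-! ### Normal forms of terms

A monomial is given by its degree function `S → ℕ`, so that the product of monomials is `+`, and
a sum of monomials is given by the set of its summands (sums are idempotent; `∅` is the term
`0`, and `{0}` the term `1`). -/

/-- `s` is periodic for `p`. -/
def Periodic (Γ : Grammar L (P ⊕ S)) (p : P) (s : S) : Prop :=
  ∃ r ∈ Γ.rules, ∃ ℓ, FormA r p s ℓ

/-- The period of `s` for `p`: the number `ℓ` in the rule `p → p ∥ s^ℓ` (which is unique in a
normalized grammar). -/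
noncomputable def period (Γ : Grammar L (P ⊕ S)) (p : P) (s : S) : ℕ :=
  sInf {ℓ | ∃ r ∈ Γ.rules, FormA r p s ℓ}

/-- `s` is bounded for `p`. -/
def Bounded (Γ : Grammar L (P ⊕ S)) (p : P) (s : S) : Prop :=
  ∃ r ∈ Γ.rules, ∃ m, FormB r p m ∧ s ∈ m

open Classical in
/-- The bound of `s` for `p`: one plus the largest exponent of `s` in a right-hand side
`s₁^ℓ₁ ∥ … ∥ s_k^ℓ_k` of `p`. -/
noncomputable def bound (Γ : Grammar L (P ⊕ S)) (p : P) (s : S) : ℕ :=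
  sSup {n | ∃ r ∈ Γ.rules, ∃ m, FormB r p m ∧ n = m.count s} + 1

/-- The monomials over the variables of the term algebra of `p`. -/
def Monomial (Γ : Grammar L (P ⊕ S)) (p : P) : Set (S → ℕ) :=
  {m | ∀ s, m s ≠ 0 → Γ.Bounded p s ∨ Γ.Periodic p s}

open Classical in
/-- Reduction of a monomial by the axioms `s ^ period = 1`, for `s` periodic. -/
noncomputable def reduce (Γ : Grammar L (P ⊕ S)) (p : P) (m : S → ℕ) : S → ℕ :=
  fun s => if Γ.Periodic p s then m s % Γ.period p s else m s

/-- The normal form of a sum of monomials: the summands are reduced by the axioms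
`s ^ bound = 0`, for `s` bounded, and `s ^ period = 1`, for `s` periodic. -/
def nf (Γ : Grammar L (P ⊕ S)) (p : P) (T : Set (S → ℕ)) : Set (S → ℕ) :=
  {m' | ∃ m ∈ T, (∀ s, Γ.Bounded p s → m s < Γ.bound p s) ∧ m' = Γ.reduce p m}

open Classical in
/-- `p ⇝ m`: there is a rule `p → s₁^ℓ₁ ∥ … ∥ s_k^ℓ_k` and `m` is the monomial
`s₁^ℓ₁ ⬝ … ⬝ s_k^ℓ_k`. -/
def LeadsTo (Γ : Grammar L (P ⊕ S)) (p : P) (m : S → ℕ) : Prop :=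
  ∃ r ∈ Γ.rules, ∃ k, FormB r p k ∧ m = fun s => k.count s

/-! ### Views and profiles -/

open Classical in
/-- The monomial `m = s₁ ⬝ … ⬝ sₙ` is a view of the P-graph `G`: there are complete derivations
`s_i →* t_i` with `G = t₁ ∥ … ∥ tₙ`. -/
def PView (Γ : Grammar L (P ⊕ S)) (G : Graph L) (m : S → ℕ) : Prop :=
  ∃ (x : S × Term L Empty) (l : List (S × Term L Empty)),
    (∀ y ∈ x :: l, Γ.Derives (Term.var (Sum.inr y.1)) y.2.lift) ∧
    Graph.Iso G (l.foldl (fun t y => Term.par t y.2) x.2).eval ∧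
    m = fun s => ((x :: l).map Prod.fst).count s

/-- The pair `(s, q)` is a view of the S-graph `G`, where `none` stands for `⊥`. -/
def SView (Γ : Grammar L (P ⊕ S)) (G : Graph L) : S × Option (P ⊕ S) → Prop
  | (s, some q) => ∃ t : Term L Empty,
      Γ.DerivesAssoc (Term.var (Sum.inr s)) (Term.ser t.lift (Term.var q)) ∧ Graph.Iso G t.eval
  | (s, none) => ∃ t : Term L Empty,
      Γ.DerivesAssoc (Term.var (Sum.inr s)) t.lift ∧ Graph.Iso G t.eval

end Grammar

/-- P-profiles are tuples of terms in normal form, S-profiles are relations. -/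
abbrev Profile (P : Type v) (S : Type w) : Type (max v w) :=
  (P → Set (S → ℕ)) ⊕ Set (S × Option (P ⊕ S))

/-- An algebra over the signature `{∘, ∥} ⊎ L`: a domain and the interpretations of the
symbols. The elements live in an ambient type `Elt`; values outside the domain play no role. -/
structure SPAlgebra (L : Type u) where
  Elt : Type v
  domain : Set Elt
  sym : L → Elt
  ser : Elt → Elt → Elt
  par : Elt → Elt → Elt

namespace Grammar

variable {L : Type u} {P : Type v} {S : Type w}

open Classical in
/-- The profile `h(G)` of an SP-graph `G`. -/
noncomputable def profile (Γ : Grammar L (P ⊕ S)) (G : Graph L) : Profile P S :=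
  if G.IsPGraph then Sum.inl (fun p => Γ.nf p {m | m ∈ Γ.Monomial p ∧ Γ.PView G m})
  else Sum.inr {y | Γ.SView G y}

open Classical in
/-- The map `par`: a profile as a tuple of terms. -/
noncomputable def toPar (Γ : Grammar L (P ⊕ S)) : Profile P S → P → Set (S → ℕ)
  | Sum.inl t => t
  | Sum.inr y => fun p => Γ.nf p {m | ∃ s, (s, none) ∈ y ∧
      (Γ.Bounded p s ∨ Γ.Periodic p s) ∧ m = Pi.single s 1}

/-- The map `seq`: a profile as a relation. -/
def toSeq (Γ : Grammar L (P ⊕ S)) : Profile P S → Set (S × Option (P ⊕ S))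
  | Sum.inl t => {y | ∃ (s : S) (p : P) (q : P ⊕ S), y = (s, some q) ∧
      (Sum.inr s, Term.ser (Term.var (Sum.inl p)) (Term.var q)) ∈ Γ.rules ∧
      ∃ m ∈ t p, Γ.LeadsTo p m}
  | Sum.inr y => y

/-- The algebra of profiles of a normalized alternative grammar. -/
noncomputable def profileAlgebra (Γ : Grammar L (P ⊕ S)) : SPAlgebra L where
  Elt := Profile P S
  domain := {x | ∃ G : Graph L, G.IsSP ∧ x = Γ.profile G}
  sym a := Γ.profile (Graph.bridge a)
  ser x₁ x₂ := Sum.inr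
    ({y | ∃ (s s' : S), (s, some (Sum.inr s')) ∈ Γ.toSeq x₁ ∧ (s', y.2) ∈ Γ.toSeq x₂ ∧ y.1 = s} ∪
     {y | ∃ (s : S) (p : P), (s, some (Sum.inl p)) ∈ Γ.toSeq x₁ ∧
        (∃ m ∈ Γ.toPar x₂ p, Γ.LeadsTo p m) ∧ y = (s, none)})
  par x₁ x₂ := Sum.inl (fun p => Γ.nf p
    {m | ∃ m₁ ∈ Γ.toPar x₁ p, ∃ m₂ ∈ Γ.toPar x₂ p, m = m₁ + m₂})

/-- The recognizer built from a regular grammar `Γ`: the algebra of profiles of the alternative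
grammar of its normal form. -/
noncomputable def recognizer (Γ : Grammar L (P ⊕ S)) : SPAlgebra L :=
  Γ.normalize.alternative.profileAlgebra

end Grammar

end SP

/-! An S-profile is a subset of a set of O(|Γ|²) pairs, so the difficulty lies with the P-profiles.
A set of reduced monomials could a priori be any subset of an exponentially large set, whereas only
2^poly many normal forms may occur for each `p`.

The sets of views are special. A ground term derived from an `S`-nonterminal is a bridge or a serial
composition, and both are indecomposable for ∥: a serial composition stays connected when its two
terminals are removed. A parallel composition of such graphs determines its components up to
isomorphism and order (`Graph.map_quotient_eq_of_iso`). Hence a view of `G` is the choice, for each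
component, of a nonterminal deriving it, and the set of relevant views depends only on a multiset
`A` of sets of nonterminals, one set per component (`Grammar.exists_views_eq`).

A large `A` can be shrunk. If a periodic, unbounded `s` occurs together with `t` in many sets, a
choice can be modified so that `t` is picked once more and `s` once less, while other degrees stay
the same modulo their periods (`exists_shift`). So the choices made on suitable `ℓ` sets containing
`s`, where `ℓ` is the period of `s`, can be transferred to the remaining sets at the cost of `ℓ`
copies of `s`, which is nothing modulo `ℓ` (`choiceValues_add`). Pigeonhole finds such sets in every
large `A` that admits a choice at all (`exists_smaller`).

Every nonempty value set therefore comes from O(|Γ|⁵) sets, each one of 2^O(|Γ|). This gives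
2^O(|Γ|⁶) normal forms for each `p` and 2^O(|Γ|⁷) tuples, well within the bound. The preparation of
the grammar at most triples the bound |Γ| on the number of nonterminals and preserves the bound on
the length of the right-hand sides. -/

namespace SP

universe u v w

namespace Graph

variable {L : Type u}

/-! ### Isomorphisms -/

theorem Iso.refl (G : Graph L) : Iso G G := ⟨Equiv.refl _, rfl, rfl, by simp⟩

theorem Iso.symm {G H : Graph L} : Iso G H → Iso H G := by
  rintro ⟨e, hs, ht, he⟩
  refine ⟨e.symm, by simp [← hs], by simp [← ht], ?_⟩
  rw [← he, Multiset.map_map]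
  simp

theorem Iso.trans {G H K : Graph L} : Iso G H → Iso H K → Iso G K := by
  rintro ⟨e, hs, ht, he⟩ ⟨f, hs', ht', hf⟩
  refine ⟨e.trans f, by simp [hs, hs'], by simp [ht, ht'], ?_⟩
  rw [← hf, ← he, Multiset.map_map]
  rfl

/-- The identification of isomorphic graphs. -/
def isoSetoid (L : Type u) : Setoid (Graph L) := ⟨Iso, Iso.refl, Iso.symm, Iso.trans⟩

/-- The map on edges induced by a map on vertices. -/
def emap {V W : Type} (f : V → W) (x : V × L × V) : W × L × W := (f x.1, x.2.1, f x.2.2)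

theorem emap_injective {V W : Type} {f : V → W} (hf : Function.Injective f) :
    Function.Injective (emap (L := L) f) := by
  rintro ⟨x, a, y⟩ ⟨x', a', y'⟩ h
  simp only [emap, Prod.mk.injEq] at h
  rw [hf h.1, h.2.1, hf h.2.2]

theorem emap_comp {V W X : Type} (f : V → W) (g : W → X) :
    emap (L := L) g ∘ emap f = emap (g ∘ f) := rfl

/-! ### Gluings -/

/-- The inner vertices. -/
def Inner (G : Graph L) (v : G.V) : Prop := v ≠ G.source ∧ v ≠ G.target

theorem iso_inner {G H : Graph L} {f : G.V → H.V} (hf : Function.Injective f)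
    (hs : f G.source = H.source) (ht : f G.target = H.target) (v : G.V) :
    H.Inner (f v) ↔ G.Inner v := by
  simp [Inner, ← hs, ← ht, hf.eq_iff]

/-- `K` is the union of the images of `G` and `H`, which have only the terminals in common. -/
structure IsGluing (G H K : Graph L) (f : G.V → K.V) (g : H.V → K.V) : Prop where
  injL : Function.Injective f
  injR : Function.Injective g
  srcL : f G.source = K.source
  tgtL : f G.target = K.target
  srcR : g H.source = K.source
  tgtR : g H.target = K.target
  surj : ∀ v, (∃ x, f x = v) ∨ ∃ y, g y = v
  disj : ∀ x y, f x = g y → ¬ G.Inner x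
  edges : K.edges = G.edges.map (emap f) + H.edges.map (emap g)

theorem parallelEmb_injective (G H : Graph L) : Function.Injective (parallelEmb G H) := by
  intro v w h
  have hst := G.source_ne_target
  unfold parallelEmb at h
  split_ifs at h <;> simp_all

theorem isGluing_parallel (G H : Graph L) :
    IsGluing G H (parallel G H) Sum.inl (parallelEmb G H) where
  injL := Sum.inl_injective
  injR := parallelEmb_injective G H
  srcL := rfl
  tgtL := rfl
  srcR := by simp [parallelEmb, parallel]
  tgtR := by simp [parallelEmb, parallel, H.source_ne_target.symm]
  surj := by
    rintro (x | ⟨y, hy⟩)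
    · exact Or.inl ⟨x, rfl⟩
    · refine Or.inr ⟨y, ?_⟩
      unfold parallelEmb
      rw [dif_neg hy.1, dif_neg hy.2]
  disj := by
    intro x y h hx
    unfold parallelEmb at h
    split_ifs at h
    · exact hx.1 (Sum.inl_injective h)
    · exact hx.2 (Sum.inl_injective h)
  edges := rfl

theorem IsGluing.symm {G H K : Graph L} {f : G.V → K.V} {g : H.V → K.V}
    (h : IsGluing G H K f g) : IsGluing H G K g f where
  injL := h.injR
  injR := h.injL
  srcL := h.srcR
  tgtL := h.tgtR
  srcR := h.srcL
  tgtR := h.tgtL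
  surj v := (h.surj v).symm
  disj := by
    intro y x hyx hy
    have h1 := h.disj x y hyx.symm
    have : x = G.source ∨ x = G.target := by unfold Inner at h1; tauto
    rcases this with rfl | rfl
    · rw [h.srcL, ← h.srcR] at hyx; exact hy.1 (h.injR hyx)
    · rw [h.tgtL, ← h.tgtR] at hyx; exact hy.2 (h.injR hyx)
  edges := by rw [h.edges, add_comm]

/-- The two parts overlap exactly in the terminals, which isomorphisms respect. So the two given
isomorphisms agree on the overlap (`key`), and their union is injective (`keyr`). -/
theorem IsGluing.iso {G H K G' H' K' : Graph L} {f : G.V → K.V} {g : H.V → K.V}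
    {f' : G'.V → K'.V} {g' : H'.V → K'.V} (h : IsGluing G H K f g) (h' : IsGluing G' H' K' f' g')
    (hG : Iso G G') (hH : Iso H H') : Iso K K' := by
  obtain ⟨e, hes, het, hee⟩ := hG
  obtain ⟨k, hks, hkt, hke⟩ := hH
  have key : ∀ x y, f x = g y → f' (e x) = g' (k y) := by
    intro x y hxy
    have h1 := h.disj x y hxy
    have : x = G.source ∨ x = G.target := by unfold Inner at h1; tauto
    rcases this with rfl | rfl
    · have : y = H.source := h.injR (by rw [← hxy, h.srcL, h.srcR])
      rw [this, hes, hks, h'.srcL, h'.srcR]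
    · have : y = H.target := h.injR (by rw [← hxy, h.tgtL, h.tgtR])
      rw [this, het, hkt, h'.tgtL, h'.tgtR]
  have hex : ∀ v, ∃ w, (∀ x, f x = v → f' (e x) = w) ∧ ∀ y, g y = v → g' (k y) = w := by
    intro v
    rcases h.surj v with ⟨x, rfl⟩ | ⟨y, rfl⟩
    · exact ⟨f' (e x), fun x' hx => by rw [h.injL hx], fun y hy => (key x y hy.symm).symm⟩
    · exact ⟨g' (k y), fun x hx => key x y hx, fun y' hy => by rw [h.injR hy]⟩
  choose φ hφ hφ' using hex
  have hφf : ∀ x, φ (f x) = f' (e x) := fun x => (hφ _ x rfl).symm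
  have hφg : ∀ y, φ (g y) = g' (k y) := fun y => (hφ' _ y rfl).symm
  have keyr : ∀ x y, f' (e x) = g' (k y) → f x = g y := by
    intro x y hxy
    have h1 := h'.disj _ _ hxy
    have : e x = G'.source ∨ e x = G'.target := by unfold Inner at h1; tauto
    rcases this with hx | hx
    · have hy : k y = H'.source := h'.injR (by rw [← hxy, hx, h'.srcL, h'.srcR])
      rw [← hes] at hx; rw [← hks] at hy
      rw [e.injective hx, k.injective hy, h.srcL, h.srcR]
    · have hy : k y = H'.target := h'.injR (by rw [← hxy, hx, h'.tgtL, h'.tgtR])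
      rw [← het] at hx; rw [← hkt] at hy
      rw [e.injective hx, k.injective hy, h.tgtL, h.tgtR]
  have hbij : Function.Bijective φ := by
    constructor
    · intro v w hvw
      rcases h.surj v with ⟨x, rfl⟩ | ⟨y, rfl⟩ <;> rcases h.surj w with ⟨x', rfl⟩ | ⟨y', rfl⟩
      · rw [hφf, hφf] at hvw; rw [e.injective (h'.injL hvw)]
      · rw [hφf, hφg] at hvw; exact keyr _ _ hvw
      · rw [hφg, hφf] at hvw; exact (keyr _ _ hvw.symm).symm
      · rw [hφg, hφg] at hvw; rw [k.injective (h'.injR hvw)]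
    · intro w
      rcases h'.surj w with ⟨x, rfl⟩ | ⟨y, rfl⟩
      · exact ⟨f (e.symm x), by rw [hφf, e.apply_symm_apply]⟩
      · exact ⟨g (k.symm y), by rw [hφg, k.apply_symm_apply]⟩
  refine ⟨Equiv.ofBijective φ hbij, ?_, ?_, ?_⟩
  · change φ K.source = _; rw [← h.srcL, hφf, hes, h'.srcL]
  · change φ K.target = _; rw [← h.tgtL, hφf, het, h'.tgtL]
  · change K.edges.map (emap φ) = _
    rw [h.edges, h'.edges, ← hee, ← hke, Multiset.map_add, Multiset.map_map, Multiset.map_map,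
      Multiset.map_map, Multiset.map_map]
    congr 1 <;> refine Multiset.map_congr rfl fun x _ => ?_
    · simp [emap, hφf]
    · simp [emap, hφg]

theorem Iso.parallel {G H G' H' : Graph L} (hG : Iso G G') (hH : Iso H H') :
    Iso (parallel G H) (parallel G' H') :=
  (isGluing_parallel G H).iso (isGluing_parallel G' H') hG hH

/-! ### Connectivity -/

/-- `X` is a union of connected components of the graph induced on the vertices in `D`. -/
def Closed (G : Graph L) (D X : G.V → Prop) : Prop :=
  ∀ e ∈ G.edges, D e.1 → D e.2.2 → (X e.1 ↔ X e.2.2)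

/-- The graph is connected, and it remains connected when one of the terminals is removed; there
are no loops. -/
structure Conn (G : Graph L) : Prop where
  all : ∀ X, G.Closed (fun _ => True) X → ∀ v, X v ↔ X G.source
  tgt : ∀ X, G.Closed (fun v => v ≠ G.source) X → ∀ v, v ≠ G.source → (X v ↔ X G.target)
  src : ∀ X, G.Closed (fun v => v ≠ G.target) X → ∀ v, v ≠ G.target → (X v ↔ X G.source)
  loopless : ∀ e ∈ G.edges, e.1 ≠ e.2.2

/-- A graph that is connected via its inner vertices. -/
structure InnerConn (G : Graph L) : Prop where
  exists_inner : ∃ v, G.Inner v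
  conn : ∀ X, G.Closed G.Inner X → ∀ v w, G.Inner v → G.Inner w → (X v ↔ X w)
  touch : ∀ e ∈ G.edges, G.Inner e.1 ∨ G.Inner e.2.2

theorem Closed.comap {G H : Graph L} {f : G.V → H.V}
    (hf : ∀ e ∈ G.edges, emap f e ∈ H.edges) {D X : H.V → Prop} {D' : G.V → Prop}
    (hD : ∀ v, D' v → D (f v)) (hX : H.Closed D X) : G.Closed D' fun v => X (f v) :=
  fun e he h1 h2 => hX _ (hf e he) (hD _ h1) (hD _ h2)

theorem conn_bridge (a : L) : Conn (bridge a) where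
  all X hX v := by
    have := hX (false, a, true) (Multiset.mem_singleton_self _) trivial trivial
    cases v
    · rfl
    · exact this.symm
  tgt X _ v hv := by
    cases v
    · exact absurd rfl hv
    · rfl
  src X _ v hv := by
    cases v
    · rfl
    · exact absurd rfl hv
  loopless e he := by
    obtain rfl := Multiset.mem_singleton.1 he
    exact Bool.false_ne_true

/-- The parts share both terminals, so each part stays linked to a common vertex even after one
terminal is removed. -/
theorem IsGluing.conn {G H K : Graph L} {f : G.V → K.V} {g : H.V → K.V}
    (h : IsGluing G H K f g) (hG : Conn G) (hH : Conn H) : Conn K := by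
  have hf : ∀ e ∈ G.edges, emap f e ∈ K.edges := fun e he => by
    rw [h.edges]; exact Multiset.mem_add.2 (Or.inl (Multiset.mem_map_of_mem _ he))
  have hg : ∀ e ∈ H.edges, emap g e ∈ K.edges := fun e he => by
    rw [h.edges]; exact Multiset.mem_add.2 (Or.inr (Multiset.mem_map_of_mem _ he))
  refine ⟨fun X hX v => ?_, fun X hX v hv => ?_, fun X hX v hv => ?_, fun e he => ?_⟩
  · rcases h.surj v with ⟨x, rfl⟩ | ⟨y, rfl⟩
    · have := hG.all _ (hX.comap hf fun _ _ => trivial) x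
      rwa [h.srcL] at this
    · have := hH.all _ (hX.comap hg fun _ _ => trivial) y
      rwa [h.srcR] at this
  · rcases h.surj v with ⟨x, rfl⟩ | ⟨y, rfl⟩
    · have := hG.tgt _ (hX.comap hf fun v hv => by rwa [← h.srcL, h.injL.ne_iff]) x
        (fun hx => hv (by rw [hx, h.srcL]))
      rwa [h.tgtL] at this
    · have := hH.tgt _ (hX.comap hg fun v hv => by rwa [← h.srcR, h.injR.ne_iff]) y
        (fun hx => hv (by rw [hx, h.srcR]))
      rwa [h.tgtR] at this
  · rcases h.surj v with ⟨x, rfl⟩ | ⟨y, rfl⟩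
    · have := hG.src _ (hX.comap hf fun v hv => by rwa [← h.tgtL, h.injL.ne_iff]) x
        (fun hx => hv (by rw [hx, h.tgtL]))
      rwa [h.srcL] at this
    · have := hH.src _ (hX.comap hg fun v hv => by rwa [← h.tgtR, h.injR.ne_iff]) y
        (fun hx => hv (by rw [hx, h.tgtR]))
      rwa [h.srcR] at this
  · rw [h.edges] at he
    rcases Multiset.mem_add.1 he with he | he <;> obtain ⟨e, he', rfl⟩ := Multiset.mem_map.1 he
    · exact h.injL.ne (hG.loopless e he')
    · exact h.injR.ne (hH.loopless e he')

theorem serialEmb_injective (G H : Graph L) : Function.Injective (serialEmb G H) := by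
  intro v w h
  unfold serialEmb at h
  split_ifs at h <;> simp_all

theorem serialEmb_source (G H : Graph L) : serialEmb G H H.source = Sum.inl G.target := by
  simp [serialEmb]

theorem serialEmb_target (G H : Graph L) :
    serialEmb G H H.target = (serial G H).target := by
  simp [serialEmb, serial, H.source_ne_target.symm]

theorem serial_surj (G H : Graph L) (v : (serial G H).V) :
    (∃ x, Sum.inl x = v) ∨ ∃ y, serialEmb G H y = v := by
  rcases v with x | ⟨y, hy⟩
  · exact Or.inl ⟨x, rfl⟩
  · exact Or.inr ⟨y, by simp [serialEmb, hy]⟩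

theorem mem_serial_left {G H : Graph L} {e : G.V × L × G.V} (he : e ∈ G.edges) :
    emap (Sum.inl : G.V → (serial G H).V) e ∈ (serial G H).edges :=
  Multiset.mem_add.2 (Or.inl (Multiset.mem_map_of_mem _ he))

theorem mem_serial_right {G H : Graph L} {e : H.V × L × H.V} (he : e ∈ H.edges) :
    emap (serialEmb G H : H.V → (serial G H).V) e ∈ (serial G H).edges :=
  Multiset.mem_add.2 (Or.inr (Multiset.mem_map_of_mem _ he))

theorem inl_ne_source {G H : Graph L} {v : G.V} :
    (Sum.inl v : (serial G H).V) ≠ (serial G H).source ↔ v ≠ G.source :=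
  Sum.inl_injective.ne_iff

theorem inl_ne_target {G H : Graph L} {v : G.V} :
    (Sum.inl v : (serial G H).V) ≠ (serial G H).target := Sum.inl_ne_inr

theorem serialEmb_ne_target {G H : Graph L} {v : H.V} :
    serialEmb G H v ≠ (serial G H).target ↔ v ≠ H.target := by
  rw [← serialEmb_target, (serialEmb_injective G H).ne_iff]

theorem serialEmb_ne_source {G H : Graph L} {v : H.V} :
    serialEmb G H v ≠ (serial G H).source := by
  have h := G.source_ne_target.symm
  unfold serialEmb serial
  split_ifs <;> simp [h]

theorem Conn.serial {G H : Graph L} (hG : Conn G) (hH : Conn H) : Conn (serial G H) := by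
  refine ⟨fun X hX => ?_, fun X hX => ?_, fun X hX => ?_, fun e he => ?_⟩
  · have h1 := hG.all _ (hX.comap (fun _ => mem_serial_left) fun _ _ => trivial)
    have h2 := hH.all _ (hX.comap (fun _ => mem_serial_right) fun _ _ => trivial)
    rw [serialEmb_source] at h2
    intro v
    rcases serial_surj G H v with ⟨x, rfl⟩ | ⟨y, rfl⟩
    · exact h1 x
    · exact (h2 y).trans (h1 _)
  · have h1 := hG.tgt _ (hX.comap (fun _ => mem_serial_left) fun _ h => inl_ne_source.2 h)
    have h2 := hH.all _ (hX.comap (fun _ => mem_serial_right) fun _ _ => serialEmb_ne_source)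
    rw [serialEmb_source] at h2
    have h3 := h2 H.target
    rw [serialEmb_target] at h3
    intro v hv
    rcases serial_surj G H v with ⟨x, rfl⟩ | ⟨y, rfl⟩
    · exact (h1 x (inl_ne_source.1 hv)).trans h3.symm
    · exact (h2 y).trans h3.symm
  · have h1 := hG.all _ (hX.comap (fun _ => mem_serial_left) fun _ _ => inl_ne_target)
    have h2 := hH.src _ (hX.comap (fun _ => mem_serial_right)
      fun _ h => serialEmb_ne_target.2 h)
    rw [serialEmb_source] at h2
    intro v hv
    rcases serial_surj G H v with ⟨x, rfl⟩ | ⟨y, rfl⟩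
    · exact h1 x
    · exact (h2 y (serialEmb_ne_target.1 hv)).trans (h1 _)
  · rcases Multiset.mem_add.1 he with he | he <;> obtain ⟨e, he', rfl⟩ := Multiset.mem_map.1 he
    · exact Sum.inl_injective.ne (hG.loopless e he')
    · exact (serialEmb_injective G H).ne (hH.loopless e he')

/-- The gluing vertex is inner. Every vertex of `G` other than its source, and every vertex of `H`
other than its target, is linked to it without passing through a terminal of the composition.
Without loops, no edge lies entirely on the terminals. -/
theorem innerConn_serial {G H : Graph L} (hG : Conn G) (hH : Conn H) :
    InnerConn (serial G H) := by
  refine ⟨⟨Sum.inl G.target, inl_ne_source.2 G.source_ne_target.symm, inl_ne_target⟩,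
    fun X hX => ?_, fun e he => ?_⟩
  · have h1 := hG.tgt _ (hX.comap (fun _ => mem_serial_left)
      fun _ h => ⟨inl_ne_source.2 h, inl_ne_target⟩)
    have h2 := hH.src _ (hX.comap (fun _ => mem_serial_right)
      fun _ h => ⟨serialEmb_ne_source, serialEmb_ne_target.2 h⟩)
    rw [serialEmb_source] at h2
    have : ∀ v, (serial G H).Inner v → (X v ↔ X (Sum.inl G.target)) := by
      intro v hv
      rcases serial_surj G H v with ⟨x, rfl⟩ | ⟨y, rfl⟩
      · exact h1 x (inl_ne_source.1 hv.1)
      · exact h2 y (serialEmb_ne_target.1 hv.2)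
    exact fun v w hv hw => (this v hv).trans (this w hw).symm
  · rcases Multiset.mem_add.1 he with he | he <;> obtain ⟨e, he', rfl⟩ := Multiset.mem_map.1 he
    · by_cases h : e.1 = G.source
      · exact Or.inr ⟨inl_ne_source.2 fun h' => hG.loopless e he' (h.trans h'.symm), inl_ne_target⟩
      · exact Or.inl ⟨inl_ne_source.2 h, inl_ne_target⟩
    · by_cases h : e.1 = H.target
      · exact Or.inr ⟨serialEmb_ne_source,
          serialEmb_ne_target.2 fun h' => hH.loopless e he' (h.trans h'.symm)⟩
      · exact Or.inl ⟨serialEmb_ne_source, serialEmb_ne_target.2 h⟩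

/-! ### Counting blocks -/

/-- The edge has an endpoint in `U`. -/
def Touches {V : Type} (U : Set V) (e : V × L × V) : Prop := e.1 ∈ U ∨ e.2.2 ∈ U

open Classical in
/-- The set `U` of inner vertices, with the edges that have an endpoint in `U`, is a copy of `H`. -/
def IsBlock (H G : Graph L) (U : Set G.V) : Prop :=
  ∃ φ : H.V → G.V, Function.Injective φ ∧ φ H.source = G.source ∧ φ H.target = G.target ∧
    U = φ '' {v | H.Inner v} ∧ H.edges.map (emap φ) = G.edges.filter (Touches U)

/-- The number of copies of `H` in `G`. -/
noncomputable def blockCount (H G : Graph L) : ℕ := {U | IsBlock H G U}.ncard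

theorem touches_image_iff {V W : Type} {f : V → W} (hf : Function.Injective f) (U : Set V)
    (e : V × L × V) : Touches (f '' U) (emap f e) ↔ Touches U e := by
  simp [Touches, emap, hf.eq_iff]

open Classical in
theorem filter_touches_image {V W : Type} {f : V → W} (hf : Function.Injective f) (U : Set V)
    (E : Multiset (V × L × V)) :
    (E.map (emap f)).filter (Touches (f '' U)) = (E.filter (Touches U)).map (emap f) := by
  rw [Multiset.filter_map]
  congr 1
  exact Multiset.filter_congr fun e _ => touches_image_iff hf U e

theorem IsBlock.of_iso {H G G' : Graph L} {e : G.V ≃ G'.V} (hs : e G.source = G'.source)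
    (ht : e G.target = G'.target) (he : G.edges.map (emap e) = G'.edges) {U : Set G.V}
    (hU : IsBlock H G U) : IsBlock H G' (e '' U) := by
  obtain ⟨φ, h1, h2, h3, rfl, h5⟩ := hU
  refine ⟨e ∘ φ, e.injective.comp h1, by simp [h2, hs], by simp [h3, ht],
    by rw [Set.image_comp], ?_⟩
  rw [← he, filter_touches_image e.injective, ← h5, Multiset.map_map]
  rfl

theorem blockCount_le_of_iso {H G G' : Graph L} (h : Iso G G') :
    blockCount H G ≤ blockCount H G' := by
  have := G'.finite_V
  obtain ⟨e, hs, ht, he⟩ := h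
  have hinj : Function.Injective (Set.image e) := Set.image_injective.2 e.injective
  rw [blockCount, ← Set.ncard_image_of_injective _ hinj]
  refine Set.ncard_le_ncard ?_ (Set.toFinite _)
  rintro _ ⟨U, hU, rfl⟩
  exact hU.of_iso hs ht he

theorem blockCount_congr {H G G' : Graph L} (h : Iso G G') : blockCount H G = blockCount H G' :=
  le_antisymm (blockCount_le_of_iso h) (blockCount_le_of_iso h.symm)

open Classical in
-- An inner vertex of the left part is not in the right part, so no edge of the right part meets
-- `U`.
theorem IsGluing.filter_touches {G H K : Graph L} {f : G.V → K.V} {g : H.V → K.V}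
    (h : IsGluing G H K f g) {U : Set G.V} (hU : ∀ v ∈ U, G.Inner v) :
    K.edges.filter (Touches (f '' U)) = (G.edges.filter (Touches U)).map (emap f) := by
  rw [h.edges, Multiset.filter_add, filter_touches_image h.injL]
  convert add_zero _
  rw [Multiset.filter_eq_nil]
  intro e he
  obtain ⟨e, -, rfl⟩ := Multiset.mem_map.1 he
  rintro (⟨x, hx, hxe⟩ | ⟨x, hx, hxe⟩)
  · exact h.disj _ _ hxe (hU x hx)
  · exact h.disj _ _ hxe (hU x hx)

theorem IsBlock.inner {H G : Graph L} {U : Set G.V} (hU : IsBlock H G U) :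
    ∀ v ∈ U, G.Inner v := by
  obtain ⟨φ, h1, h2, h3, rfl, -⟩ := hU
  rintro _ ⟨v, hv, rfl⟩
  exact (iso_inner h1 h2 h3 v).2 hv

theorem IsBlock.nonempty {H G : Graph L} (hH : InnerConn H) {U : Set G.V} (hU : IsBlock H G U) :
    U.Nonempty := by
  obtain ⟨φ, -, -, -, rfl, -⟩ := hU
  obtain ⟨v, hv⟩ := hH.exists_inner
  exact ⟨φ v, v, hv, rfl⟩

theorem IsGluing.isBlock_image {H₀ G H K : Graph L} {f : G.V → K.V} {g : H.V → K.V}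
    (h : IsGluing G H K f g) {U : Set G.V} (hU : IsBlock H₀ G U) : IsBlock H₀ K (f '' U) := by
  have hi := hU.inner
  obtain ⟨φ, h1, h2, h3, rfl, h5⟩ := hU
  refine ⟨f ∘ φ, h.injL.comp h1, by simp [h2, h.srcL], by simp [h3, h.tgtL],
    by rw [Set.image_comp], ?_⟩
  rw [h.filter_touches hi, ← h5, Multiset.map_map]
  rfl

/-- A converse to `IsGluing.isBlock_image`: a copy whose inner vertices all lie in the left part can
be pulled back, since the terminals lie there anyway. -/
theorem IsGluing.isBlock_of_range {H₀ G H K : Graph L} {f : G.V → K.V} {g : H.V → K.V}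
    (h : IsGluing G H K f g) {φ : H₀.V → K.V} (h1 : Function.Injective φ)
    (h2 : φ H₀.source = K.source) (h3 : φ H₀.target = K.target) {U : Set K.V}
    (hU : U = φ '' {v | H₀.Inner v})
    (h5 : H₀.edges.map (emap φ) = K.edges.filter (fun e => @decide (Touches U e) (Classical.dec _)))
    (hr : ∀ v, H₀.Inner v → ∃ x, f x = φ v) : ∃ U', IsBlock H₀ G U' ∧ f '' U' = U := by
  classical
  have hr' : ∀ v, ∃ x, f x = φ v := by
    intro v
    by_cases hv : H₀.Inner v
    · exact hr v hv
    · have : v = H₀.source ∨ v = H₀.target := by unfold Inner at hv; tauto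
      rcases this with rfl | rfl
      · exact ⟨G.source, by rw [h.srcL, h2]⟩
      · exact ⟨G.target, by rw [h.tgtL, h3]⟩
  choose ψ hψ using hr'
  have hφ : φ = f ∘ ψ := funext fun v => (hψ v).symm
  subst hφ
  have hψi : Function.Injective ψ := h1.of_comp
  have hψs : ψ H₀.source = G.source := h.injL (by rw [h.srcL]; exact h2)
  have hψt : ψ H₀.target = G.target := h.injL (by rw [h.tgtL]; exact h3)
  rw [Set.image_comp] at hU
  subst hU
  refine ⟨ψ '' {v | H₀.Inner v}, ⟨ψ, hψi, hψs, hψt, rfl, ?_⟩, rfl⟩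
  apply Multiset.map_injective (emap_injective h.injL)
  rw [Multiset.map_map, emap_comp, h5, ← h.filter_touches (H := H) (g := g)]
  · exact Multiset.filter_congr fun e _ => by simp
  · rintro _ ⟨v, hv, rfl⟩
    exact (iso_inner hψi hψs hψt v).2 hv

/-- Each edge of `K` lies in one of the two parts, so crossing an edge between inner vertices never
changes sides. As `H₀` is connected via its inner vertices, a copy of it lies wholly on one side. -/
theorem IsGluing.isBlock_iff {H₀ G H K : Graph L} (hH : InnerConn H₀) {f : G.V → K.V}
    {g : H.V → K.V} (h : IsGluing G H K f g) :
    {U | IsBlock H₀ K U} = Set.image f '' {U | IsBlock H₀ G U} ∪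
      Set.image g '' {U | IsBlock H₀ H U} := by
  classical
  ext U
  constructor
  · rintro ⟨φ, h1, h2, h3, hU, h5⟩
    have hcl : H₀.Closed H₀.Inner fun v => ∃ x, f x = φ v := by
      intro e he hi1 hi2
      have hmem : emap φ e ∈ K.edges := by
        have : emap φ e ∈ K.edges.filter (Touches U) := by
          rw [← h5]; exact Multiset.mem_map_of_mem _ he
        exact (Multiset.mem_filter.1 this).1
      have hno : ∀ v y, H₀.Inner v → g y = φ v → ¬ ∃ x, f x = φ v := by
        rintro v y hv hy ⟨x, hx⟩
        have hx' := h.disj x y (hx.trans hy.symm)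
        rw [← iso_inner h1 h2 h3, ← hx, iso_inner h.injL h.srcL h.tgtL] at hv
        exact hx' hv
      rw [h.edges] at hmem
      rcases Multiset.mem_add.1 hmem with hm | hm <;>
        obtain ⟨e', -, he'⟩ := Multiset.mem_map.1 hm
      · have e1 : f e'.1 = φ e.1 := congrArg Prod.fst he'
        have e2 : f e'.2.2 = φ e.2.2 := congrArg (fun x => x.2.2) he'
        exact iff_of_true ⟨_, e1⟩ ⟨_, e2⟩
      · have e1 : g e'.1 = φ e.1 := congrArg Prod.fst he'
        have e2 : g e'.2.2 = φ e.2.2 := congrArg (fun x => x.2.2) he'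
        exact iff_of_false (hno _ _ hi1 e1) (hno _ _ hi2 e2)
    obtain ⟨v₀, hv₀⟩ := hH.exists_inner
    have h5' : H₀.edges.map (emap φ) =
        K.edges.filter (fun e => @decide (Touches U e) (Classical.dec _)) := by
      rw [h5]; exact Multiset.filter_congr fun e _ => by simp
    by_cases hx : ∃ x, f x = φ v₀
    · left
      exact h.isBlock_of_range h1 h2 h3 hU h5' fun v hv => (hH.conn _ hcl v v₀ hv hv₀).2 hx
    · right
      refine h.symm.isBlock_of_range h1 h2 h3 hU h5' fun v hv => ?_
      exact (h.surj (φ v)).resolve_left fun hv' => hx ((hH.conn _ hcl v v₀ hv hv₀).1 hv')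
  · rintro (⟨U, hU, rfl⟩ | ⟨U, hU, rfl⟩)
    · exact h.isBlock_image hU
    · exact h.symm.isBlock_image hU

theorem blockCount_parallel {H₀ : Graph L} (hH : InnerConn H₀) (G H : Graph L) :
    blockCount H₀ (parallel G H) = blockCount H₀ G + blockCount H₀ H := by
  have h := isGluing_parallel G H
  have := (parallel G H).finite_V
  rw [blockCount, h.isBlock_iff hH, Set.ncard_union_eq,
    Set.ncard_image_of_injective _ (Set.image_injective.2 h.injL),
    Set.ncard_image_of_injective _ (Set.image_injective.2 h.injR)]
  · rfl
  · rw [Set.disjoint_left]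
    rintro _ ⟨U, hU, rfl⟩ ⟨U', hU', hUU⟩
    obtain ⟨x, hx⟩ := hU.nonempty hH
    obtain ⟨y, -, hy⟩ := hUU.ge (Set.mem_image_of_mem Sum.inl hx)
    exact h.disj x y hy.symm (hU.inner x hx)

/-- All edges meeting `U` are images of edges of `H`, so `U` cannot be left along an edge between
inner vertices. Connectivity of `G` then forces `U` to contain all inner vertices. -/
theorem isBlock_of_innerConn {H G : Graph L} (hH : InnerConn H) (hG : InnerConn G) {U : Set G.V}
    (hU : IsBlock H G U) : Iso H G ∧ U = {v | G.Inner v} := by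
  classical
  have hi := hU.inner
  obtain ⟨φ, h1, h2, h3, hUφ, h5⟩ := hU
  have hall : ∀ v, G.Inner v → v ∈ U := by
    have hcl : G.Closed G.Inner (· ∈ U) := by
      have key : ∀ e ∈ G.edges, Touches U e → G.Inner e.1 → G.Inner e.2.2 →
          e.1 ∈ U ∧ e.2.2 ∈ U := by
        intro e he ht hi1 hi2
        have : e ∈ H.edges.map (emap φ) := by rw [h5]; exact Multiset.mem_filter.2 ⟨he, ht⟩
        obtain ⟨e', -, rfl⟩ := Multiset.mem_map.1 this
        rw [hUφ]
        exact ⟨⟨_, (iso_inner h1 h2 h3 _).1 hi1, rfl⟩, ⟨_, (iso_inner h1 h2 h3 _).1 hi2, rfl⟩⟩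
      exact fun e he hi1 hi2 => ⟨fun h => (key e he (Or.inl h) hi1 hi2).2,
        fun h => (key e he (Or.inr h) hi1 hi2).1⟩
    obtain ⟨v₀, hv₀⟩ := hH.exists_inner
    have hmem : φ v₀ ∈ U := hUφ ▸ ⟨v₀, hv₀, rfl⟩
    exact fun v hv => (hG.conn _ hcl v (φ v₀) hv (hi _ hmem)).2 hmem
  refine ⟨⟨Equiv.ofBijective φ ⟨h1, fun v => ?_⟩, h2, h3, ?_⟩,
    Set.ext fun v => ⟨hi v, hall v⟩⟩
  · by_cases hv : G.Inner v
    · have := hall v hv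
      rw [hUφ] at this
      obtain ⟨x, -, hx⟩ := this
      exact ⟨x, hx⟩
    · have : v = G.source ∨ v = G.target := by unfold Inner at hv; tauto
      rcases this with rfl | rfl
      · exact ⟨_, h2⟩
      · exact ⟨_, h3⟩
  · change H.edges.map (emap φ) = _
    rw [h5, Multiset.filter_eq_self]
    exact fun e he => (hG.touch e he).imp (hall _) (hall _)

theorem isBlock_self {G : Graph L} (hG : InnerConn G) : IsBlock G G {v | G.Inner v} := by
  classical
  refine ⟨id, Function.injective_id, rfl, rfl, by simp, ?_⟩
  refine (Multiset.map_id _).trans ?_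
  rw [eq_comm, Multiset.filter_eq_self]
  exact fun e he => hG.touch e he

open Classical in
theorem blockCount_of_innerConn {H G : Graph L} (hH : InnerConn H) (hG : InnerConn G) :
    blockCount H G = if Iso H G then 1 else 0 := by
  split_ifs with h
  · rw [← blockCount_congr h, blockCount, Set.ncard_eq_one]
    exact ⟨_, Set.eq_singleton_iff_unique_mem.2
      ⟨isBlock_self hH, fun U hU => (isBlock_of_innerConn hH hH hU).2⟩⟩
  · rw [blockCount, show {U | IsBlock H G U} = ∅ from
      Set.eq_empty_of_forall_notMem fun U hU => h (isBlock_of_innerConn hH hG hU).1]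
    exact Set.ncard_empty _

theorem not_inner_bridge (a : L) (v : (bridge a).V) : ¬ (bridge a).Inner v := by
  rintro ⟨h1, h2⟩
  cases v
  · exact h1 rfl
  · exact h2 rfl

theorem blockCount_bridge {H : Graph L} (hH : InnerConn H) (a : L) :
    blockCount H (bridge a) = 0 := by
  rw [blockCount, show {U | IsBlock H (bridge a) U} = ∅ from
    Set.eq_empty_of_forall_notMem fun U hU => ?_]
  · exact Set.ncard_empty _
  · obtain ⟨v, hv⟩ := hU.nonempty hH
    exact not_inner_bridge a v (hU.inner v hv)

/-! ### Counting bridges -/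

open Classical in
/-- The number of `a`-labelled edges from source to target. -/
noncomputable def bridgeCount (a : L) (G : Graph L) : ℕ := G.edges.count (G.source, a, G.target)

theorem bridgeCount_congr {a : L} {G G' : Graph L} (h : Iso G G') :
    bridgeCount a G = bridgeCount a G' := by
  classical
  obtain ⟨e, hs, ht, he⟩ := h
  have := Multiset.count_map_eq_count' (emap (L := L) e) G.edges (emap_injective e.injective)
    (G.source, a, G.target)
  rw [bridgeCount, bridgeCount, ← he, ← hs, ← ht]
  exact this.symm

theorem bridgeCount_parallel (a : L) (G H : Graph L) :
    bridgeCount a (parallel G H) = bridgeCount a G + bridgeCount a H := by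
  classical
  have h := isGluing_parallel G H
  rw [bridgeCount, h.edges, Multiset.count_add]
  congr 1
  · rw [← h.srcL, ← h.tgtL]
    exact Multiset.count_map_eq_count' (emap (L := L) _) G.edges (emap_injective h.injL)
      (G.source, a, G.target)
  · rw [← h.srcR, ← h.tgtR]
    exact Multiset.count_map_eq_count' (emap (L := L) _) H.edges (emap_injective h.injR)
      (H.source, a, H.target)

theorem bridgeCount_of_innerConn (a : L) {G : Graph L} (hG : InnerConn G) :
    bridgeCount a G = 0 := by
  classical
  refine Multiset.count_eq_zero_of_notMem fun h => ?_
  rcases hG.touch _ h with h | h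
  · exact h.1 rfl
  · exact h.2 rfl

open Classical in
theorem bridgeCount_bridge (a b : L) :
    bridgeCount a (bridge b) = if a = b then 1 else 0 := by
  rw [bridgeCount, show (bridge b).edges = {((bridge b).source, b, (bridge b).target)} from rfl,
    Multiset.count_singleton]
  simp

theorem iso_bridge_iff {a b : L} : Iso (bridge a) (bridge b) ↔ a = b := by
  refine ⟨fun h => ?_, fun h => h ▸ Iso.refl _⟩
  have := bridgeCount_congr (a := a) h
  rw [bridgeCount_bridge, bridgeCount_bridge, if_pos rfl] at this
  by_contra hab
  simp [hab] at this

/-! ### Unique decomposition -/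

/-- Graphs that are indecomposable with respect to the parallel composition. -/
inductive Prime : Graph L → Prop
  | bridge (a : L) : Prime (bridge a)
  | inner {G : Graph L} : InnerConn G → Prime G

-- Additive invariants dual to the isomorphism classes of primes: `bridgeCount` for a bridge,
-- `blockCount` for an inner-connected graph. Evaluating them on a parallel composition reads off
-- the multiplicity of each component.
open Classical in
theorem Prime.exists_count {H : Graph L} (hH : Prime H) : ∃ κ : Graph L → ℕ,
    (∀ G G', Iso G G' → κ G = κ G') ∧ (∀ G G', κ (parallel G G') = κ G + κ G') ∧
    ∀ G, Prime G → κ G = if Iso H G then 1 else 0 := by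
  have hne : ∀ {G : Graph L} {a : L}, InnerConn G → ¬ Iso (Graph.bridge a) G := by
    intro G a hG h
    have h1 := bridgeCount_congr (a := a) h
    rw [bridgeCount_of_innerConn a hG, bridgeCount_bridge] at h1
    simp at h1
  cases hH with
  | bridge a =>
    refine ⟨bridgeCount a, fun G G' h => bridgeCount_congr h, bridgeCount_parallel a, ?_⟩
    rintro _ (b | hG)
    · rw [bridgeCount_bridge]; simp [iso_bridge_iff]
    · rw [bridgeCount_of_innerConn a hG, if_neg (hne hG)]
  | inner hH =>
    refine ⟨blockCount H, fun G G' h => blockCount_congr h, blockCount_parallel hH, ?_⟩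
    rintro _ (b | hG)
    · rw [blockCount_bridge hH, if_neg fun h => hne hH h.symm]
    · exact blockCount_of_innerConn hH hG

/-- The parallel composition of a nonempty list of graphs. -/
noncomputable def parallelList (G : Graph L) (l : List (Graph L)) : Graph L := l.foldl parallel G

theorem count_parallelList {κ : Graph L → ℕ}
    (hκ : ∀ G G', κ (parallel G G') = κ G + κ G') (G : Graph L) (l : List (Graph L)) :
    κ (parallelList G l) = ((G :: l).map κ).sum := by
  induction l generalizing G with
  | nil => simp [parallelList]
  | cons H l ih =>
    rw [parallelList, List.foldl_cons, ← parallelList, ih]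
    simp [hκ, add_assoc]

theorem Iso.parallelList {G G' : Graph L} {l l' : List (Graph L)} (h : Iso G G')
    (hl : List.Forall₂ Iso l l') : Iso (parallelList G l) (parallelList G' l') := by
  induction hl generalizing G G' with
  | nil => exact h
  | cons h' _ ih => exact ih (h.parallel h')

theorem map_quotient_eq_of_iso {G G' : Graph L} {l l' : List (Graph L)}
    (hl : ∀ H ∈ G :: l, Prime H) (hl' : ∀ H ∈ G' :: l', Prime H)
    (h : Iso (parallelList G l) (parallelList G' l')) :
    ((G :: l : List (Graph L)) : Multiset (Graph L)).map (Quotient.mk (isoSetoid L)) =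
      ((G' :: l' : List (Graph L)) : Multiset (Graph L)).map (Quotient.mk (isoSetoid L)) := by
  classical
  have key : ∀ {H : Graph L} {κ : Graph L → ℕ}, (∀ G, Prime G → κ G = if Iso H G then 1 else 0) →
      ∀ l : List (Graph L), (∀ G ∈ l, Prime G) →
      (l.map κ).sum = ((l : Multiset (Graph L)).map (Quotient.mk (isoSetoid L))).count
        (Quotient.mk (isoSetoid L) H) := by
    intro H κ hκ l hl
    induction l with
    | nil => simp
    | cons K l ih =>
      have ih := ih fun G hG => hl G (by simp [hG])
      rw [List.map_cons, List.sum_cons, ih, ← Multiset.cons_coe, Multiset.map_cons,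
        Multiset.count_cons, hκ K (hl K (by simp)), add_comm]
      congr 1
      refine if_congr ?_ rfl rfl
      exact (Quotient.eq (r := isoSetoid L)).symm
  ext c
  by_cases hc : ∃ H, Prime H ∧ c = Quotient.mk (isoSetoid L) H
  · obtain ⟨H, hH, rfl⟩ := hc
    obtain ⟨κ, h1, h2, h3⟩ := hH.exists_count
    rw [← key h3 _ hl, ← key h3 _ hl', ← count_parallelList h2, ← count_parallelList h2]
    exact h1 _ _ h
  -- A class without a prime representative occurs on neither side.
  · rw [Multiset.count_eq_zero_of_notMem, Multiset.count_eq_zero_of_notMem]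
    · intro hmem
      obtain ⟨H, hH, rfl⟩ := Multiset.mem_map.1 hmem
      exact hc ⟨H, hl' H (by simpa using hH), rfl⟩
    · intro hmem
      obtain ⟨H, hH, rfl⟩ := Multiset.mem_map.1 hmem
      exact hc ⟨H, hl H (by simpa using hH), rfl⟩

end Graph

/-! ### Connectivity of the values of ground terms -/

namespace Term

variable {L : Type u}

theorem conn_eval (t : Term L Empty) : t.eval.Conn := by
  induction t with
  | sym a => exact Graph.conn_bridge a
  | var x => exact x.elim
  | ser t₁ t₂ h₁ h₂ => exact h₁.serial h₂
  | par t₁ t₂ h₁ h₂ => exact (Graph.isGluing_parallel _ _).conn h₁ h₂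

theorem prime_eval_ser (t₁ t₂ : Term L Empty) : (ser t₁ t₂).eval.Prime :=
  .inner (Graph.innerConn_serial t₁.conn_eval t₂.conn_eval)

end Term

/-! ### Pigeonhole principles for multisets -/

theorem exists_le_card_eq {α : Type*} {s : Multiset α} {n : ℕ} (h : n ≤ Multiset.card s) :
    ∃ t ≤ s, Multiset.card t = n := by
  induction s using Quot.inductionOn with
  | h l => exact ⟨(l.take n : Multiset α), (List.take_sublist n l).subperm, by simpa using h⟩

theorem countP_le_sum {α β : Type*} (R : Finset β) (p : α → Prop) (q : β → α → Prop)
    [DecidablePred p] [∀ t, DecidablePred (q t)] (z : Multiset α)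
    (h : ∀ x ∈ z, p x → ∃ t ∈ R, q t x) :
    z.countP p ≤ ∑ t ∈ R, z.countP (q t) := by
  induction z using Multiset.induction_on with
  | empty => simp
  | cons a z ih =>
    have ih := ih fun x hx => h x (Multiset.mem_cons_of_mem hx)
    simp only [Multiset.countP_cons, Finset.sum_add_distrib]
    by_cases hp : p a
    · obtain ⟨t, ht, hq⟩ := h a (Multiset.mem_cons_self a z) hp
      have : (if q t a then 1 else 0) ≤ ∑ t ∈ R, if q t a then 1 else 0 :=
        Finset.single_le_sum (f := fun t => if q t a then 1 else 0) (fun _ _ => Nat.zero_le _) ht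
      simp only [hp, if_true]
      simp only [hq, if_true] at this
      omega
    · simp only [hp, if_false]; omega

theorem exists_lt_countP {α β : Type*} (R : Finset β) (p : α → Prop) (q : β → α → Prop)
    [DecidablePred p] [∀ t, DecidablePred (q t)] (z : Multiset α)
    (h : ∀ x ∈ z, p x → ∃ t ∈ R, q t x) {c k : ℕ} (hR : R.card ≤ c)
    (hk : c * k < z.countP p) : ∃ t ∈ R, k < z.countP (q t) := by
  by_contra! hcon
  have h1 := countP_le_sum R p q z h
  have h2 := Finset.sum_le_card_nsmul R _ k hcon
  have h3 : R.card * k ≤ c * k := Nat.mul_le_mul_right k hR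
  simp only [smul_eq_mul] at h2
  omega

/-! ### Choices -/

section Choices

open Classical in
/-- The number of times that `v` is chosen in `z`. -/
noncomputable def deg {σ : Type*} (z : Multiset (σ × Finset σ)) (v : σ) : ℕ :=
  (z.map Prod.fst).count v

/-- `z` chooses an element from each set of the multiset `A`. -/
def IsChoice {σ : Type*} (z : Multiset (σ × Finset σ)) (A : Multiset (Finset σ)) : Prop :=
  z.map Prod.snd = A ∧ ∀ x ∈ z, x.1 ∈ x.2

/-- The degree functions, modulo `ℓ`, of the choices from `A` that respect the bounds `bd` on the
variables `b` with `ℓ b = 0`. -/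
def choiceValues {σ : Type*} (ℓ bd : σ → ℕ) (A : Multiset (Finset σ)) : Set (σ → ℕ) :=
  {m | ∃ z, IsChoice z A ∧ (∀ b, ℓ b = 0 → deg z b ≠ 0 → deg z b < bd b) ∧ m = fun v => deg z v % ℓ v}

open Classical

variable {σ : Type*} {ℓ bd : σ → ℕ}

theorem deg_add (y z : Multiset (σ × Finset σ)) (v : σ) : deg (y + z) v = deg y v + deg z v := by
  simp [deg]

theorem deg_cons (x : σ × Finset σ) (z : Multiset (σ × Finset σ)) (v : σ) :
    deg (x ::ₘ z) v = deg z v + if v = x.1 then 1 else 0 := by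
  simp [deg, Multiset.count_cons]

theorem deg_eq_card_mul {u : σ} {z : Multiset (σ × Finset σ)} (h : ∀ x ∈ z, x.1 = u) (v : σ) :
    deg z v = if v = u then Multiset.card z else 0 := by
  have : z.map Prod.fst = Multiset.replicate (Multiset.card z) u := by
    rw [Multiset.eq_replicate]; simpa using fun a b hb => h _ hb
  rw [deg, this, Multiset.count_replicate]
  simp [eq_comm]

theorem deg_eq_countP (z : Multiset (σ × Finset σ)) (v : σ) :
    deg z v = z.countP fun x => x.1 = v := by
  rw [deg, Multiset.count, Multiset.countP_map, Multiset.countP_eq_card_filter]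
  simp [eq_comm]

/-- If there are many sets that contain both `s` and `t`, then a choice can be changed so as to
pick `t` once more and `s` once less, modulo `ℓ`. -/
theorem exists_shift {R : Finset σ} {c N W : ℕ} (hR : R.card ≤ c) (hN : ∀ s, ℓ s ≤ N)
    {z : Multiset (σ × Finset σ)} {A : Multiset (Finset σ)} (hz : IsChoice z A)
    (hzR : ∀ x ∈ z, x.1 ∈ R)
    (hW : z.countP (fun x => ℓ x.1 = 0) ≤ W) {s t : σ} (hs : ℓ s ≠ 0)
    (hK : W + c * N ^ 2 < A.countP fun B => s ∈ B ∧ t ∈ B) :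
    ∃ z', IsChoice z' A ∧
      ∀ v, deg z' v + (if v = s then 1 else 0) ≡ deg z v + (if v = t then 1 else 0) [MOD ℓ v] := by
  obtain ⟨rfl, hmem⟩ := hz
  have h1 : W + c * N ^ 2 < z.countP fun x => s ∈ x.2 ∧ t ∈ x.2 := by
    rwa [Multiset.countP_map, ← Multiset.countP_eq_card_filter] at hK
  have h2 : z.countP (fun x => s ∈ x.2 ∧ t ∈ x.2) ≤
      z.countP (fun x => (s ∈ x.2 ∧ t ∈ x.2) ∧ ℓ x.1 ≠ 0) + z.countP (fun x => ℓ x.1 = 0) := by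
    have := countP_le_sum (Finset.univ : Finset Bool) (fun x => s ∈ x.2 ∧ t ∈ x.2)
      (fun b x => if b then (s ∈ x.2 ∧ t ∈ x.2) ∧ ℓ x.1 ≠ 0 else ℓ x.1 = 0) z (by
        intro x _ hx
        by_cases h0 : ℓ x.1 = 0
        · exact ⟨false, Finset.mem_univ _, by simpa using h0⟩
        · exact ⟨true, Finset.mem_univ _, by simpa [h0] using hx⟩)
    simpa using this
  -- At most `W` of the sets containing both `s` and `t` are used for a variable of modulus `0`.
  -- Among the others, more than `N ^ 2` share the same chosen element `u`.
  obtain ⟨u, -, hu⟩ := exists_lt_countP R (fun x => (s ∈ x.2 ∧ t ∈ x.2) ∧ ℓ x.1 ≠ 0)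
    (fun u x => x.1 = u ∧ s ∈ x.2 ∧ t ∈ x.2 ∧ ℓ u ≠ 0) z
    (fun x hx hp => ⟨x.1, hzR x hx, rfl, hp.1.1, hp.1.2, hp.2⟩) hR (k := N ^ 2) (by omega)
  have hu0 : ℓ u ≠ 0 := by
    obtain ⟨x, -, hx⟩ := Multiset.countP_pos.1 (lt_of_le_of_lt (Nat.zero_le _) hu)
    exact hx.2.2.2
  have hk : ℓ s * ℓ u ≤ N ^ 2 := by
    rw [pow_two]; exact Nat.mul_le_mul (hN s) (hN u)
  rw [Multiset.countP_eq_card_filter] at hu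
  -- The number `ℓ s * ℓ u` vanishes modulo both `ℓ s` and `ℓ u`, so that many picks can be moved
  -- from `u` to `s` for free.
  obtain ⟨y, hy, hcard⟩ := exists_le_card_eq (hk.trans hu.le)
  have hyz : y ≤ z := hy.trans (Multiset.filter_le _ _)
  have hyu : ∀ x ∈ y, x.1 = u ∧ s ∈ x.2 ∧ t ∈ x.2 := fun x hx => by
    have := (Multiset.mem_filter.1 (Multiset.mem_of_le hy hx)).2
    exact ⟨this.1, this.2.1, this.2.2.1⟩
  obtain ⟨w, rfl⟩ := Multiset.le_iff_exists_add.1 hyz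
  have hpos : 0 < Multiset.card y := by rw [hcard]; positivity
  obtain ⟨x, hx⟩ := Multiset.card_pos_iff_exists_mem.1 hpos
  obtain ⟨y, rfl⟩ := Multiset.exists_cons_of_mem hx
  -- All the selected picks of `u` become picks of `s`, except one, which becomes a pick of `t`.
  refine ⟨(t, x.2) ::ₘ (y.map (fun q => (s, q.2)) + w), ⟨?_, ?_⟩, ?_⟩
  · simp
  · intro q hq
    simp only [Multiset.mem_cons, Multiset.mem_add, Multiset.mem_map] at hq
    rcases hq with rfl | ⟨q', hq', rfl⟩ | hq
    · exact (hyu x (by simp)).2.2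
    · exact (hyu q' (by simp [hq'])).2.1
    · exact hmem q (by simp [hq])
  · intro v
    have e1 : deg (y.map fun q => (s, q.2)) v = if v = s then Multiset.card y else 0 := by
      rw [deg_eq_card_mul (u := s) (by simp +contextual [eq_comm])]; simp
    have e2 := deg_eq_card_mul (fun q hq => (hyu q hq).1) v
    have e3 : Multiset.card y + 1 = ℓ s * ℓ u := by simpa using hcard
    rw [deg_add, e2, hcard, deg_cons, deg_add, e1]
    have h3 : (if v = s then ℓ s * ℓ u else 0) ≡ 0 [MOD ℓ v] := by
      split_ifs with h
      · subst h; exact (Nat.modEq_zero_iff_dvd).2 (dvd_mul_right _ _)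
      · rfl
    have h4 : (if v = u then ℓ s * ℓ u else 0) ≡ 0 [MOD ℓ v] := by
      split_ifs with h
      · subst h; exact (Nat.modEq_zero_iff_dvd).2 (dvd_mul_left _ _)
      · rfl
    have h5 := (h3.trans h4.symm).add_right (deg w v + if v = t then 1 else 0)
    convert h5 using 1
    · rw [← e3]; dsimp only; split_ifs <;> omega
    · omega

/-- Modulus `0` marks the variables whose degree is kept exactly: `% 0` is the identity and
congruence modulo `0` is equality. An admissible choice can use each of them only a bounded number
of times. -/
theorem countP_le_of_deg_lt {R : Finset σ} {c b₀ : ℕ} (hR : R.card ≤ c) (hb : ∀ s, bd s ≤ b₀)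
    {z : Multiset (σ × Finset σ)} (hzR : ∀ x ∈ z, x.1 ∈ R)
    (hlt : ∀ b, ℓ b = 0 → deg z b ≠ 0 → deg z b < bd b) :
    z.countP (fun x => ℓ x.1 = 0) ≤ c * b₀ := by
  by_contra! hcon
  obtain ⟨t, -, ht⟩ := exists_lt_countP R (fun x => ℓ x.1 = 0) (fun t x => x.1 = t ∧ ℓ t = 0) z
    (fun x hx h => ⟨x.1, hzR x hx, rfl, h⟩) hR hcon
  have ht0 : ℓ t = 0 := by
    obtain ⟨x, -, hx⟩ := Multiset.countP_pos.1 (lt_of_le_of_lt (Nat.zero_le _) ht)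
    exact hx.2
  have := hlt t ht0
  rw [deg_eq_countP] at this
  simp only [ht0, and_true] at ht
  have := this (by omega)
  have := hb t
  omega

/-- The picks in `z` are transferred one by one into the choice from `E` by `exists_shift`, each
costing one pick of `s`. -/
theorem exists_choice_of_add {R : Finset σ} {c N b₀ : ℕ} (hR : R.card ≤ c) (hN : ∀ s, ℓ s ≤ N)
    (hb : ∀ s, bd s ≤ b₀) {E : Multiset (Finset σ)} (hER : ∀ B ∈ E, B ⊆ R)
    {s : σ} (hs : ℓ s ≠ 0) {y : Multiset (σ × Finset σ)} (hE : IsChoice y E)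
    (z : Multiset (σ × Finset σ))
    (hz : ∀ x ∈ z, c * b₀ + c * N ^ 2 < E.countP fun B => s ∈ B ∧ x.1 ∈ B)
    (hlt : ∀ b, ℓ b = 0 → deg (y + z) b ≠ 0 → deg (y + z) b < bd b) :
    ∃ y', IsChoice y' E ∧
      ∀ v, deg y' v + (if v = s then Multiset.card z else 0) ≡ deg (y + z) v [MOD ℓ v] := by
  induction z using Multiset.induction_on with
  | empty => exact ⟨y, hE, fun v => by simp [Nat.ModEq.refl]⟩
  | cons x z ih =>
    have hle : ∀ b, deg (y + z) b ≤ deg (y + x ::ₘ z) b := fun b => by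
      rw [deg_add, deg_add, deg_cons]; omega
    obtain ⟨y', hy', hdeg⟩ := ih (fun x hx => hz x (Multiset.mem_cons_of_mem hx))
      (fun b h0 h1 => lt_of_le_of_lt (hle b) (hlt b h0 (by have := hle b; omega)))
    -- Degrees of modulus `0` are exact, so the intermediate choice still respects the bounds, and
    -- the same `W = c * b₀` serves at every stage.
    have hdeg0 : ∀ b, ℓ b = 0 → deg y' b = deg (y + z) b := fun b h0 => by
      have := hdeg b
      have hbs : b ≠ s := by rintro rfl; exact hs h0
      simpa [h0, hbs, Nat.modEq_zero_iff] using this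
    have hW := countP_le_of_deg_lt (ℓ := ℓ) (bd := bd) (z := y') hR hb
      (fun x hx => hER x.2 (hy'.1 ▸ Multiset.mem_map_of_mem _ hx) (hy'.2 x hx))
      (fun b h0 h1 => by
        rw [hdeg0 b h0] at h1 ⊢
        exact lt_of_le_of_lt (hle b) (hlt b h0 (by have := hle b; omega)))
    obtain ⟨y'', hy'', hdeg'⟩ := exists_shift hR hN hy'
      (fun x hx => hER x.2 (hy'.1 ▸ Multiset.mem_map_of_mem _ hx) (hy'.2 x hx)) hW hs
      (hz x (Multiset.mem_cons_self x z))
    refine ⟨y'', hy'', fun v => ?_⟩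
    have h1 := (hdeg' v).add_right (if v = s then Multiset.card z else 0)
    have h2 := (hdeg v).add_right (if v = x.1 then 1 else 0)
    rw [deg_add] at h2 ⊢
    rw [deg_cons]
    have h3 : deg y' v + (if v = x.1 then 1 else 0) + (if v = s then Multiset.card z else 0) =
      deg y' v + (if v = s then Multiset.card z else 0) + (if v = x.1 then 1 else 0) := by omega
    rw [h3] at h1
    convert h1.trans h2 using 1
    · rw [Multiset.card_cons]; split_ifs <;> omega
    · omega

theorem exists_add_of_map_eq_add {α β : Type*} {f : α → β} {z : Multiset α} {D E : Multiset β}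
    (h : z.map f = E + D) : ∃ y w, z = y + w ∧ y.map f = E ∧ w.map f = D := by
  induction D using Multiset.induction_on generalizing z with
  | empty => exact ⟨z, 0, by simp, by simpa using h, by simp⟩
  | cons d D ih =>
    rw [Multiset.add_cons] at h
    obtain ⟨a, ha, rfl, h'⟩ := (Multiset.map_eq_cons _ _ _ _).2 h
    obtain ⟨y, w, hz, hy, hw⟩ := ih h'
    refine ⟨y, a ::ₘ w, ?_, hy, by simp [hw]⟩
    rw [Multiset.add_cons, ← hz, Multiset.cons_erase ha]

/-- One inclusion transfers the picks on `D` into `E`, losing `ℓ s` picks of `s`. The other picks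
`s` from each of the `ℓ s` sets of `D`. Neither affects degrees modulo `ℓ`. -/
theorem choiceValues_add {R : Finset σ} {c N b₀ : ℕ} (hR : R.card ≤ c) (hN : ∀ s, ℓ s ≤ N)
    (hb : ∀ s, bd s ≤ b₀) {D E : Multiset (Finset σ)} (hER : ∀ B ∈ E, B ⊆ R)
    {s : σ} (hs : ℓ s ≠ 0) (hD : Multiset.card D = ℓ s) (hsD : ∀ B ∈ D, s ∈ B)
    (hK : ∀ B ∈ D, ∀ t ∈ B, c * b₀ + c * N ^ 2 < E.countP fun B => s ∈ B ∧ t ∈ B) :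
    choiceValues ℓ bd (E + D) = choiceValues ℓ bd E := by
  have hmod : ∀ v, (if v = s then ℓ s else 0) ≡ 0 [MOD ℓ v] := fun v => by
    split_ifs with h
    · subst h; simp
    · rfl
  have hb0 : ∀ y z : Multiset (σ × Finset σ), (∀ v, deg y v ≡ deg z v [MOD ℓ v]) →
      ∀ b, ℓ b = 0 → deg y b = deg z b := fun y z h b h0 => by
    simpa [h0, Nat.modEq_zero_iff] using h b
  ext m
  constructor
  · rintro ⟨z, ⟨hz, hmem⟩, hlt, rfl⟩
    obtain ⟨y, w, rfl, hy, hw⟩ := exists_add_of_map_eq_add hz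
    obtain ⟨y', hy', hdeg⟩ := exists_choice_of_add hR hN hb hER hs
      (⟨hy, fun x hx => hmem x (by simp [hx])⟩ : IsChoice y E) w (fun x hx =>
        hK x.2 (hw ▸ Multiset.mem_map_of_mem _ hx) _ (hmem x (by simp [hx]))) hlt
    have hcard : Multiset.card w = ℓ s := by rw [← hD, ← hw, Multiset.card_map]
    rw [hcard] at hdeg
    have hdeg' : ∀ v, deg y' v ≡ deg (y + w) v [MOD ℓ v] := fun v => by
      simpa using ((hmod v).add_left (deg y' v)).symm.trans (hdeg v)
    refine ⟨y', hy', fun b h0 => ?_, ?_⟩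
    · rw [hb0 _ _ hdeg' b h0]; exact hlt b h0
    · funext v; exact (hdeg' v).symm
  · rintro ⟨y, ⟨hy, hmem⟩, hlt, rfl⟩
    have hdeg : ∀ v, deg (y + D.map fun B => (s, B)) v ≡ deg y v [MOD ℓ v] := fun v => by
      rw [deg_add, deg_eq_card_mul (z := D.map _) (u := s) (by simp +contextual [eq_comm]),
        Multiset.card_map, hD]
      simpa using (hmod v).add_left (deg y v)
    refine ⟨y + D.map fun B => (s, B), ⟨by simp [hy], ?_⟩, fun b h0 => ?_, ?_⟩
    · intro x hx
      rcases Multiset.mem_add.1 hx with hx | hx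
      · exact hmem x hx
      · obtain ⟨B, hB, rfl⟩ := Multiset.mem_map.1 hx
        exact hsD B hB
    · rw [hb0 _ _ hdeg b h0]; exact hlt b h0
    · funext v; exact (hdeg v).symm

/-- Unless there are no values at all, some sets can be dropped from a large multiset. -/
theorem exists_smaller {R : Finset σ} {c N b₀ : ℕ} (hR : R.card ≤ c) (hN : ∀ s, ℓ s ≤ N)
    (hb : ∀ s, bd s ≤ b₀) {A : Multiset (Finset σ)} (hAR : ∀ B ∈ A, B ⊆ R)
    (hne : (choiceValues ℓ bd A).Nonempty)
    (hA : c * b₀ + c * (c * (c * b₀ + c * N ^ 2 + N) + N) < Multiset.card A) :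
    ∃ E < A, choiceValues ℓ bd A = choiceValues ℓ bd E := by
  set K := c * b₀ + c * N ^ 2 with hKdef
  -- From such a set any choice must pick a variable of modulus `0`. An admissible choice exists by
  -- `hne`, so there are few such sets.
  have h1 : A.countP (fun B => ¬ ∃ s ∈ B, ℓ s ≠ 0) ≤ c * b₀ := by
    obtain ⟨_, z, ⟨hz, hmem⟩, hlt, -⟩ := hne
    refine le_trans ?_ (countP_le_of_deg_lt (ℓ := ℓ) hR hb (fun x hx =>
      hAR x.2 (hz ▸ Multiset.mem_map_of_mem _ hx) (hmem x hx)) hlt)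
    rw [← hz, Multiset.countP_map, ← Multiset.countP_eq_card_filter]
    have := countP_le_sum {()} (fun x => ¬ ∃ s ∈ x.2, ℓ s ≠ 0) (fun _ x => ℓ x.1 = 0) z
      fun x hx h => ⟨(), by simp, by
        by_contra h0; exact h ⟨x.1, hmem x hx, h0⟩⟩
    simpa using this
  have h2 := Multiset.card_eq_countP_add_countP (fun B => ∃ s ∈ B, ℓ s ≠ 0) A
  obtain ⟨s, -, hs⟩ := exists_lt_countP R (fun B => ∃ s ∈ B, ℓ s ≠ 0) (fun s B => s ∈ B ∧ ℓ s ≠ 0) A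
    (fun B hB ⟨s, hs, h0⟩ => ⟨s, hAR B hB hs, hs, h0⟩) hR (k := c * (K + N) + N) (by omega)
  have hs0 : ℓ s ≠ 0 := by
    obtain ⟨x, -, hx⟩ := Multiset.countP_pos.1 (lt_of_le_of_lt (Nat.zero_le _) hs)
    exact hx.2
  simp only [hs0, ne_eq, not_false_eq_true, and_true] at hs
  -- The margin `N` keeps the co-occurrence counts above `K` after `ℓ s ≤ N` sets have been removed.
  let good : Finset σ → Prop := fun B =>
    s ∈ B ∧ ∀ t ∈ B, K + N < A.countP fun B => s ∈ B ∧ t ∈ B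
  have h3 : A.countP (fun B => s ∈ B) ≤ A.countP good +
      A.countP (fun B => s ∈ B ∧ ¬ good B) := by
    have := countP_le_sum (Finset.univ : Finset Bool) (fun B => s ∈ B)
      (fun b B => if b then good B else s ∈ B ∧ ¬ good B) A (by
        intro B _ hB
        by_cases h0 : good B
        · exact ⟨true, Finset.mem_univ _, by simpa using h0⟩
        · exact ⟨false, Finset.mem_univ _, by simpa [h0] using hB⟩)
    simpa using this
  -- Each bad set contains some `t` that rarely occurs together with `s`, and each such `t` accounts
  -- for at most `K + N` sets.
  have h4 : A.countP (fun B => s ∈ B ∧ ¬ good B) ≤ c * (K + N) := by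
    by_contra! hcon
    obtain ⟨t, -, ht⟩ := exists_lt_countP R (fun B => s ∈ B ∧ ¬ good B)
      (fun t B => (s ∈ B ∧ t ∈ B) ∧ A.countP (fun B => s ∈ B ∧ t ∈ B) ≤ K + N) A (by
        rintro B hB ⟨hsB, hbad⟩
        simp only [good, not_and, not_forall, not_lt] at hbad
        obtain ⟨t, ht, hle⟩ := hbad hsB
        exact ⟨t, hAR B hB ht, ⟨hsB, ht⟩, hle⟩) hR hcon
    by_cases h : A.countP (fun B => s ∈ B ∧ t ∈ B) ≤ K + N
    · simp only [h, and_true] at ht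
      omega
    · simp [h] at ht
  have h5 : ℓ s ≤ Multiset.card (A.filter good) := by
    rw [← Multiset.countP_eq_card_filter]
    have := hN s
    omega
  obtain ⟨D, hD, hcard⟩ := exists_le_card_eq h5
  have hDgood : ∀ B ∈ D, good B := fun B hB =>
    (Multiset.mem_filter.1 (Multiset.mem_of_le hD hB)).2
  obtain ⟨E, rfl⟩ := Multiset.le_iff_exists_add.1 (hD.trans (Multiset.filter_le _ _))
  refine ⟨E, ?_, ?_⟩
  · refine lt_of_le_of_ne (Multiset.le_add_left _ _) fun h => ?_
    have := congrArg Multiset.card h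
    rw [Multiset.card_add] at this
    omega
  · rw [add_comm]
    refine choiceValues_add hR hN hb (fun B hB => hAR B (by simp [hB])) hs0 hcard
      (fun B hB => (hDgood B hB).1) fun B hB t ht => ?_
    have h6 := (hDgood B hB).2 t ht
    have h7 := Multiset.countP_le_card (fun B => s ∈ B ∧ t ∈ B) D
    rw [Multiset.countP_add] at h6
    have := hN s
    omega

theorem exists_card_le {R : Finset σ} {c N b₀ : ℕ} (hR : R.card ≤ c) (hN : ∀ s, ℓ s ≤ N)
    (hb : ∀ s, bd s ≤ b₀) (A : Multiset (Finset σ)) (hAR : ∀ B ∈ A, B ⊆ R)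
    (hne : (choiceValues ℓ bd A).Nonempty) :
    ∃ E : Multiset (Finset σ), (∀ B ∈ E, B ⊆ R) ∧
      Multiset.card E ≤ c * b₀ + c * (c * (c * b₀ + c * N ^ 2 + N) + N) ∧
      choiceValues ℓ bd A = choiceValues ℓ bd E := by
  induction A using Multiset.strongInductionOn with
  | ih A ih =>
    by_cases hA : c * b₀ + c * (c * (c * b₀ + c * N ^ 2 + N) + N) < Multiset.card A
    · obtain ⟨E, hE, heq⟩ := exists_smaller hR hN hb hAR hne hA
      obtain ⟨E', h1, h2, h3⟩ := ih E hE (fun B hB => hAR B (Multiset.mem_of_le hE.le hB))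
        (heq ▸ hne)
      exact ⟨E', h1, h2, heq.trans h3⟩
    · exact ⟨A, hAR, not_lt.1 hA, rfl⟩

theorem ncard_multiset_le {α : Type*} (X : Finset α) (n : ℕ) :
    {m : Multiset α | (∀ a ∈ m, a ∈ X) ∧ Multiset.card m ≤ n}.Finite ∧
    {m : Multiset α | (∀ a ∈ m, a ∈ X) ∧ Multiset.card m ≤ n}.ncard ≤ (X.card + 1) ^ n := by
  induction n with
  | zero =>
    have : {m : Multiset α | (∀ a ∈ m, a ∈ X) ∧ Multiset.card m ≤ 0} = {0} := by
      ext m; simp only [Nat.le_zero, Multiset.card_eq_zero, Set.mem_ofPred_eq,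
        Set.mem_singleton_iff, and_iff_right_iff_imp]
      rintro rfl; simp
    rw [this]; simp
  | succ n ih =>
    set T := {m : Multiset α | (∀ a ∈ m, a ∈ X) ∧ Multiset.card m ≤ n} with hT
    have hsub : {m : Multiset α | (∀ a ∈ m, a ∈ X) ∧ Multiset.card m ≤ n + 1} ⊆
        T ∪ (fun q : α × Multiset α => q.1 ::ₘ q.2) '' ((X : Set α) ×ˢ T) := by
      rintro m ⟨hm, hc⟩
      induction m using Multiset.induction_on with
      | empty => left; simp [hT]
      | cons a m _ =>
        right
        exact ⟨(a, m), ⟨hm a (by simp), fun b hb => hm b (by simp [hb]), by simpa using hc⟩, rfl⟩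
    have hfin : ((X : Set α) ×ˢ T).Finite := X.finite_toSet.prod ih.1
    have hfin2 := ih.1.union (hfin.image fun q : α × Multiset α => q.1 ::ₘ q.2)
    refine ⟨hfin2.subset hsub, ?_⟩
    calc _ ≤ _ := Set.ncard_le_ncard hsub hfin2
      _ ≤ _ := Set.ncard_union_le _ _
      _ ≤ T.ncard + X.card * T.ncard := by
        gcongr
        refine (Set.ncard_image_le hfin).trans ?_
        rw [Set.ncard_prod, Set.ncard_coe_finset]
      _ = (X.card + 1) * T.ncard := by ring
      _ ≤ (X.card + 1) ^ (n + 1) := by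
        rw [pow_succ']; exact Nat.mul_le_mul_left _ ih.2

/-- There are few sets of values of choices. -/
theorem ncard_choiceValues_le (ℓ bd : σ → ℕ) {R : Finset σ} {c N b₀ : ℕ} (hR : R.card ≤ c)
    (hN : ∀ s, ℓ s ≤ N) (hb : ∀ s, bd s ≤ b₀) :
    {T | ∃ A : Multiset (Finset σ), (∀ B ∈ A, B ⊆ R) ∧ T = choiceValues ℓ bd A}.Finite ∧
    {T | ∃ A : Multiset (Finset σ), (∀ B ∈ A, B ⊆ R) ∧ T = choiceValues ℓ bd A}.ncard ≤
      2 ^ ((c + 1) * (c * b₀ + c * (c * (c * b₀ + c * N ^ 2 + N) + N)) + 1) := by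
  set M := c * b₀ + c * (c * (c * b₀ + c * N ^ 2 + N) + N)
  obtain ⟨hfin, hcard⟩ := ncard_multiset_le R.powerset M
  set Y := {m : Multiset (Finset σ) | (∀ a ∈ m, a ∈ R.powerset) ∧ Multiset.card m ≤ M}
  have hsub : {T | ∃ A : Multiset (Finset σ), (∀ B ∈ A, B ⊆ R) ∧ T = choiceValues ℓ bd A} ⊆
      insert ∅ (choiceValues ℓ bd '' Y) := by
    rintro _ ⟨A, hA, rfl⟩
    -- If no choice is admissible, `A` need not be reducible, but the value is then the single set
    -- `∅`.
    rcases (choiceValues ℓ bd A).eq_empty_or_nonempty with h | h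
    · left; exact h
    · obtain ⟨E, h1, h2, h3⟩ := exists_card_le hR hN hb A hA h
      right
      exact ⟨E, ⟨fun B hB => Finset.mem_powerset.2 (h1 B hB), h2⟩, h3.symm⟩
  have hfin2 := (hfin.image (choiceValues ℓ bd)).insert ∅
  refine ⟨hfin2.subset hsub, ?_⟩
  calc _ ≤ _ := Set.ncard_le_ncard hsub hfin2
    _ ≤ _ := Set.ncard_insert_le _ _
    _ ≤ (2 ^ c + 1) ^ M + 1 := by
      gcongr
      refine (Set.ncard_image_le hfin).trans (hcard.trans ?_)
      rw [Finset.card_powerset]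
      gcongr
      norm_num
    _ ≤ (2 ^ (c + 1)) ^ M + (2 ^ (c + 1)) ^ M := by
      gcongr
      · rw [pow_succ]; have := Nat.one_le_two_pow (n := c); omega
      · exact Nat.one_le_pow _ _ (by positivity)
    _ = 2 ^ ((c + 1) * M + 1) := by rw [← pow_mul, pow_succ]; ring

end Choices

/-! ### Variables and sizes of terms -/

namespace Term

variable {L : Type u} {N : Type v} {M : Type w}

open Classical in
/-- The variables of a term. -/
noncomputable def vars : Term L N → Finset N
  | sym _ => ∅
  | var x => {x}
  | ser t₁ t₂ => t₁.vars ∪ t₂.vars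
  | par t₁ t₂ => t₁.vars ∪ t₂.vars

theorem card_vars_le (t : Term L N) : t.vars.card ≤ t.size := by
  classical
  induction t with
  | sym a => simp [vars]
  | var x => simp [vars, size]
  | ser t₁ t₂ h₁ h₂ =>
    have := Finset.card_union_le t₁.vars t₂.vars
    simp only [vars, size]; omega
  | par t₁ t₂ h₁ h₂ =>
    have := Finset.card_union_le t₁.vars t₂.vars
    simp only [vars, size]; omega

theorem vars_lift (t : Term L Empty) : (t.lift : Term L N).vars = ∅ := by
  induction t with
  | sym a => rfl
  | var x => exact x.elim
  | ser t₁ t₂ h₁ h₂ => simp only [lift] at h₁ h₂; simp [lift, map, vars, h₁, h₂]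
  | par t₁ t₂ h₁ h₂ => simp only [lift] at h₁ h₂; simp [lift, map, vars, h₁, h₂]

theorem size_map (f : N → M) (t : Term L N) : (t.map f).size = t.size := by
  induction t <;> simp_all [map, size]

theorem one_le_size (t : Term L N) : 1 ≤ t.size := by cases t <;> simp [size]

theorem mem_vars_map {f : N → M} {t : Term L N} {y : M} (h : y ∈ (t.map f).vars) :
    ∃ x ∈ t.vars, f x = y := by
  induction t with
  | sym a => simp [map, vars] at h
  | var x => exact ⟨x, by simp [vars], by simpa [map, vars, eq_comm] using h⟩
  | ser t₁ t₂ h₁ h₂ =>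
    simp only [map, vars, Finset.mem_union] at h ⊢
    rcases h with h | h
    · obtain ⟨x, hx, e⟩ := h₁ h; exact ⟨x, Or.inl hx, e⟩
    · obtain ⟨x, hx, e⟩ := h₂ h; exact ⟨x, Or.inr hx, e⟩
  | par t₁ t₂ h₁ h₂ =>
    simp only [map, vars, Finset.mem_union] at h ⊢
    rcases h with h | h
    · obtain ⟨x, hx, e⟩ := h₁ h; exact ⟨x, Or.inl hx, e⟩
    · obtain ⟨x, hx, e⟩ := h₂ h; exact ⟨x, Or.inr hx, e⟩

theorem AssocEq.vars_eq {t u : Term L N} (h : AssocEq t u) : t.vars = u.vars := by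
  induction h with
  | assoc => simp [vars, Finset.union_assoc]
  | refl => rfl
  | symm _ ih => exact ih.symm
  | trans _ _ ih₁ ih₂ => exact ih₁.trans ih₂
  | ser _ _ ih₁ ih₂ => simp [vars, ih₁, ih₂]
  | par _ _ ih₁ ih₂ => simp [vars, ih₁, ih₂]

theorem AssocEq.size_eq {t u : Term L N} (h : AssocEq t u) : t.size = u.size := by
  induction h with
  | assoc => simp [size]; omega
  | refl => rfl
  | symm _ ih => exact ih.symm
  | trans _ _ ih₁ ih₂ => exact ih₁.trans ih₂
  | ser _ _ ih₁ ih₂ => simp [size, ih₁, ih₂]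
  | par _ _ ih₁ ih₂ => simp [size, ih₁, ih₂]

theorem IsPar.card_le {t : Term L N} {m : Multiset N} (h : t.IsPar m) :
    Multiset.card m ≤ t.size := by
  induction h with
  | var x => simp [size]
  | par _ _ ih₁ ih₂ => simp only [Multiset.card_add, size]; omega

theorem eval_foldl_par {α : Type*} (f : α → Term L Empty) (x : Term L Empty) (l : List α) :
    (l.foldl (fun t y => par t (f y)) x).eval =
      Graph.parallelList x.eval (l.map fun y => (f y).eval) := by
  induction l generalizing x with
  | nil => rfl
  | cons y l ih => exact ih (par x (f y))

end Term

/-! ### Occurring nonterminals and the shape of derivations -/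

namespace Grammar

variable {L : Type u}

section

variable {N : Type v} (Γ : Grammar L N)

open Classical in
/-- The nonterminals that occur in the rules. -/
noncomputable def nonterminals : Finset N :=
  Γ.finite_rules.toFinset.biUnion fun r => insert r.1 r.2.vars

variable {Γ}

theorem mem_nonterminals {x : N} :
    x ∈ Γ.nonterminals ↔ ∃ r ∈ Γ.rules, x = r.1 ∨ x ∈ r.2.vars := by
  classical
  simp [nonterminals]

theorem head_mem {r : N × Term L N} (hr : r ∈ Γ.rules) : r.1 ∈ Γ.nonterminals :=
  mem_nonterminals.2 ⟨r, hr, Or.inl rfl⟩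

theorem card_nonterminals_le : Γ.nonterminals.card ≤ Γ.size := by
  classical
  refine Finset.card_biUnion_le.trans (Finset.sum_le_sum fun r _ => ?_)
  have h1 := Finset.card_insert_le r.1 r.2.vars
  have h2 := r.2.card_vars_le
  convert h1.trans (by omega : r.2.vars.card + 1 ≤ 2 + r.2.size)

theorem size_le_of_mem {r : N × Term L N} (hr : r ∈ Γ.rules) : r.2.size ≤ Γ.size := by
  have := Finset.single_le_sum (f := fun r : N × Term L N => 2 + r.2.size)
    (fun _ _ => Nat.zero_le _) (Γ.finite_rules.mem_toFinset.2 hr)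
  change _ ≤ Γ.size at this
  omega

theorem ncard_rules_le : Γ.rules.ncard ≤ Γ.size := by
  rw [Set.ncard_eq_toFinset_card _ Γ.finite_rules]
  have := Finset.card_nsmul_le_sum Γ.finite_rules.toFinset (fun r => 2 + r.2.size) 1
    fun r _ => by omega
  simpa [size] using this

theorem Step.vars_subset {t u : Term L N} (h : Γ.Step t u) {x : N} (hx : x ∈ u.vars) :
    x ∈ t.vars ∨ x ∈ Γ.nonterminals := by
  classical
  induction h with
  | rule hr => exact Or.inr (mem_nonterminals.2 ⟨_, hr, Or.inr hx⟩)
  | serL u _ ih => simp only [Term.vars, Finset.mem_union] at hx ⊢; tauto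
  | serR u _ ih => simp only [Term.vars, Finset.mem_union] at hx ⊢; tauto
  | parL u _ ih => simp only [Term.vars, Finset.mem_union] at hx ⊢; tauto
  | parR u _ ih => simp only [Term.vars, Finset.mem_union] at hx ⊢; tauto

theorem Derives.vars_subset {t u : Term L N} (h : Γ.Derives t u) {x : N} (hx : x ∈ u.vars) :
    x ∈ t.vars ∨ x ∈ Γ.nonterminals := by
  induction h with
  | refl => exact Or.inl hx
  | tail _ h ih => exact (h.vars_subset hx).elim ih Or.inr

theorem Derives.var {x : N} {t : Term L N} (h : Γ.Derives (Term.var x) t) :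
    t = Term.var x ∨ ∃ r, (x, r) ∈ Γ.rules ∧ Γ.Derives r t := by
  rcases Relation.ReflTransGen.cases_head h with h | ⟨r, hr, h⟩
  · exact Or.inl h.symm
  · cases hr with
    | rule hr => exact Or.inr ⟨r, hr, h⟩

theorem Derives.sym {a : L} {t : Term L N} (h : Γ.Derives (Term.sym a) t) : t = Term.sym a := by
  rcases Relation.ReflTransGen.cases_head h with h | ⟨r, hr, h⟩
  · exact h.symm
  · cases hr

theorem Derives.ser {t₁ t₂ t : Term L N} (h : Γ.Derives (Term.ser t₁ t₂) t) :
    ∃ u₁ u₂, t = Term.ser u₁ u₂ := by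
  induction h with
  | refl => exact ⟨_, _, rfl⟩
  | tail _ h ih =>
    obtain ⟨u₁, u₂, rfl⟩ := ih
    cases h <;> exact ⟨_, _, rfl⟩

end

variable {P : Type v} {S : Type w} {Δ : Grammar L (P ⊕ S)}

/-- The rules for the nonterminals in `S` are of the forms `s → t₁ ∘ t₂` and `s → a`. -/
def SeqRules (Δ : Grammar L (P ⊕ S)) : Prop :=
  ∀ s t, ((Sum.inr s : P ⊕ S), t) ∈ Δ.rules →
    (∃ a, t = Term.sym a) ∨ ∃ t₁ t₂, t = Term.ser t₁ t₂

theorem Derives.head_mem {x : P ⊕ S} {t : Term L Empty}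
    (h : Δ.Derives (Term.var x) t.lift) : x ∈ Δ.nonterminals := by
  rcases h.var with h | ⟨r, hr, -⟩
  · have := congrArg Term.vars h
    rw [Term.vars_lift] at this
    exact absurd this.symm (by simp [Term.vars])
  · exact Grammar.head_mem hr

/-- The first rule applied fixes the outermost symbol of the derived term: a letter or `∘`. -/
theorem SeqRules.prime (hΔ : Δ.SeqRules) {s : S} {t : Term L Empty}
    (h : Δ.Derives (Term.var (Sum.inr s)) t.lift) : t.eval.Prime := by
  rcases h.var with h | ⟨r, hr, h⟩
  · cases t with
    | var x => exact x.elim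
    | _ => simp [Term.lift, Term.map] at h
  · rcases hΔ s r hr with ⟨a, rfl⟩ | ⟨t₁, t₂, rfl⟩
    · have h := h.sym
      cases t with
      | sym b => exact .bridge b
      | var x => exact x.elim
      | _ => simp [Term.lift, Term.map] at h
    · obtain ⟨u₁, u₂, h⟩ := h.ser
      cases t with
      | ser t₁ t₂ => exact Term.prime_eval_ser t₁ t₂
      | var x => exact x.elim
      | _ => simp [Term.lift, Term.map] at h

/-! ### Views of P-graphs -/

open Classical in
/-- The relevant nonterminals for `p`. -/
noncomputable def relevant (Δ : Grammar L (P ⊕ S)) (p : P) : Finset S :=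
  Δ.nonterminals.toRight.filter fun s => Δ.Bounded p s ∨ Δ.Periodic p s

open Classical in
/-- The relevant nonterminals for `p` that derive a graph in the isomorphism class `c`. -/
noncomputable def derivers (Δ : Grammar L (P ⊕ S)) (p : P) (c : Quotient (Graph.isoSetoid L)) :
    Finset S :=
  (Δ.relevant p).filter fun s => ∃ t : Term L Empty,
    Δ.Derives (Term.var (Sum.inr s)) t.lift ∧ Quotient.mk _ t.eval = c

theorem relevant_card_le (Δ : Grammar L (P ⊕ S)) (p : P) :
    (Δ.relevant p).card ≤ Δ.nonterminals.card := by
  classical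
  exact (Finset.card_filter_le _ _).trans Finset.card_toRight_le

/-- Realizes an abstract choice by derivations: each chosen nonterminal derives some graph
isomorphic to the component whose set it was chosen from. -/
theorem exists_derivations {p : P} (l₀ : List (S × Term L Empty)) (z : Multiset (S × Finset S))
    (hz : IsChoice z ((l₀ : Multiset (S × Term L Empty)).map
      fun y => Δ.derivers p (Quotient.mk _ y.2.eval))) :
    ∃ l : List (S × Term L Empty), (l.map Prod.fst : Multiset S) = z.map Prod.fst ∧
      (∀ y ∈ l, Δ.Derives (Term.var (Sum.inr y.1)) y.2.lift) ∧
      List.Forall₂ Graph.Iso (l₀.map fun y => y.2.eval) (l.map fun y => y.2.eval) := by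
  classical
  induction l₀ generalizing z with
  | nil =>
    have : z = 0 := by simpa [IsChoice] using hz.1
    exact ⟨[], by simp [this], by simp, by simp⟩
  | cons y l₀ ih =>
    obtain ⟨h1, h2⟩ := hz
    rw [← Multiset.cons_coe, Multiset.map_cons] at h1
    obtain ⟨x, hx, hxy, h1⟩ := (Multiset.map_eq_cons _ _ _ _).2 h1
    obtain ⟨l, hl1, hl2, hl3⟩ := ih (z.erase x) ⟨h1, fun q hq => h2 q (Multiset.mem_of_mem_erase hq)⟩
    have hmem := h2 x hx
    rw [hxy] at hmem
    obtain ⟨-, t, ht, hc⟩ := Finset.mem_filter.1 hmem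
    refine ⟨(x.1, t) :: l, ?_, ?_, ?_⟩
    · rw [List.map_cons, ← Multiset.cons_coe, hl1]
      conv_rhs => rw [← Multiset.cons_erase hx, Multiset.map_cons]
    · simpa using ⟨ht, fun a b hab => hl2 (a, b) hab⟩
    · exact .cons (Quotient.exact hc : Graph.Iso _ _).symm hl3

/-- The relevant views of a graph are the choices from a multiset of sets. -/
theorem exists_views_eq (hΔ : Δ.SeqRules) (p : P) (G : Graph L) :
    ∃ A : Multiset (Finset S), (∀ B ∈ A, B ⊆ Δ.relevant p) ∧
      ∀ m, (m ∈ Δ.Monomial p ∧ Δ.PView G m) ↔ ∃ z, IsChoice z A ∧ m = deg z := by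
  classical
  by_cases hG : ∃ m, Δ.PView G m
  swap
  · refine ⟨{∅}, by simp, fun m => ⟨fun h => (hG ⟨m, h.2⟩).elim, ?_⟩⟩
    rintro ⟨z, ⟨hz1, hz2⟩, -⟩
    obtain ⟨x, rfl, hx⟩ := Multiset.map_eq_singleton.1 hz1
    have := hz2 x (by simp)
    rw [hx] at this
    exact absurd this (Finset.notMem_empty _)
  obtain ⟨_, x₀, l₀, hd₀, hiso₀, -⟩ := hG
  rw [Term.eval_foldl_par] at hiso₀
  refine ⟨((x₀ :: l₀ : List (S × Term L Empty)) : Multiset (S × Term L Empty)).map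
      fun y => Δ.derivers p (Quotient.mk _ y.2.eval), ?_, fun m => ⟨?_, ?_⟩⟩
  · intro B hB
    obtain ⟨y, -, rfl⟩ := Multiset.mem_map.1 hB
    exact Finset.filter_subset _ _
  · rintro ⟨hm, x, l, hd, hiso, rfl⟩
    rw [Term.eval_foldl_par] at hiso
    -- Any view has the same components as the fixed reference view, hence the same multiset of sets
    -- of derivers.
    have hq := Graph.map_quotient_eq_of_iso (G := x.2.eval) (G' := x₀.2.eval)
      (l := l.map fun y => y.2.eval) (l' := l₀.map fun y => y.2.eval)
      (by
        intro H hH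
        obtain ⟨y, hy, rfl⟩ := List.mem_map.1 (by simpa using hH : H ∈ (x :: l).map fun y => y.2.eval)
        exact hΔ.prime (hd y hy))
      (by
        intro H hH
        obtain ⟨y, hy, rfl⟩ :=
          List.mem_map.1 (by simpa using hH : H ∈ (x₀ :: l₀).map fun y => y.2.eval)
        exact hΔ.prime (hd₀ y hy))
      (hiso.symm.trans hiso₀)
    refine ⟨((x :: l : List (S × Term L Empty)) : Multiset (S × Term L Empty)).map
      fun y => (y.1, Δ.derivers p (Quotient.mk _ y.2.eval)), ⟨?_, ?_⟩, ?_⟩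
    · have := congrArg (Multiset.map (Δ.derivers p)) hq
      rw [Multiset.map_map, Multiset.map_map, ← List.map_cons (f := fun y : S × Term L Empty => y.2.eval),
        ← List.map_cons (f := fun y : S × Term L Empty => y.2.eval), ← Multiset.map_coe,
        ← Multiset.map_coe, Multiset.map_map, Multiset.map_map] at this
      rw [Multiset.map_map]
      exact this
    · intro q hq
      obtain ⟨y, hy, rfl⟩ := Multiset.mem_map.1 hq
      have hy' : y ∈ x :: l := by simpa using hy
      refine Finset.mem_filter.2 ⟨Finset.mem_filter.2 ⟨?_, hm y.1 ?_⟩, y.2, hd y hy', rfl⟩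
      · exact Finset.mem_toRight.2 (hd y hy').head_mem
      · exact (List.count_pos_iff.2 (List.mem_map_of_mem hy')).ne'
    · funext v
      rw [deg, Multiset.map_map, Multiset.map_coe, Multiset.coe_count]
      rfl
  · rintro ⟨z, hz, rfl⟩
    constructor
    · intro s hs
      have hs' : s ∈ z.map Prod.fst := Multiset.count_ne_zero.1 hs
      obtain ⟨x, hx, rfl⟩ := Multiset.mem_map.1 hs'
      have h1 : x.2 ∈ z.map Prod.snd := Multiset.mem_map_of_mem _ hx
      rw [hz.1] at h1
      obtain ⟨y, -, hy⟩ := Multiset.mem_map.1 h1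
      have h2 := hz.2 x hx
      rw [← hy] at h2
      exact (Finset.mem_filter.1 (Finset.mem_filter.1 h2).1).2
    · obtain ⟨l, hl1, hl2, hl3⟩ := exists_derivations _ z hz
      cases l with
      | nil => cases hl3
      | cons x l =>
        cases hl3 with
        | cons h1 h2 =>
          refine ⟨x, l, hl2, ?_, ?_⟩
          · rw [Term.eval_foldl_par]
            exact hiso₀.trans (h1.parallelList h2)
          · funext v
            rw [deg, ← hl1, Multiset.coe_count]

open Classical in
/-- The modulus of a variable: its period if it is periodic but not bounded, and `0` if it is
bounded. -/
noncomputable def modulus (Δ : Grammar L (P ⊕ S)) (p : P) (s : S) : ℕ :=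
  if Δ.Periodic p s ∧ ¬ Δ.Bounded p s then Δ.period p s else 0

theorem period_mem {p : P} {s : S} (h : Δ.Periodic p s) :
    ∃ r ∈ Δ.rules, FormA r p s (Δ.period p s) := by
  obtain ⟨r, hr, ℓ, hℓ⟩ := h
  exact Nat.sInf_mem (s := {ℓ | ∃ r ∈ Δ.rules, FormA r p s ℓ}) ⟨ℓ, r, hr, hℓ⟩

theorem modulus_le {N : ℕ} (hN : ∀ r ∈ Δ.rules, r.2.size ≤ N) (p : P) (s : S) :
    Δ.modulus p s ≤ N := by
  unfold modulus
  split_ifs with h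
  · obtain ⟨r, hr, -, -, hpar⟩ := period_mem h.1
    have := hpar.card_le.trans (hN r hr)
    simp only [Multiset.card_cons, Multiset.card_replicate] at this
    omega
  · exact Nat.zero_le _

theorem bound_le {N : ℕ} (hN : ∀ r ∈ Δ.rules, r.2.size ≤ N) (p : P) (s : S) :
    Δ.bound p s ≤ N + 1 := by
  classical
  refine Nat.succ_le_succ (csSup_le' ?_)
  rintro _ ⟨r, hr, m, hm, rfl⟩
  have := hm.2.card_le.trans (hN r hr)
  rw [Multiset.card_map] at this
  exact (Multiset.count_le_card _ _).trans this

/-- A variable that is both bounded and periodic needs its exact degree for the bound test. It has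
modulus `0` in `choiceValues`, and `reduce` is applied afterwards. -/
theorem nf_views (hΔ : Δ.SeqRules) (p : P) (G : Graph L) :
    ∃ A : Multiset (Finset S), (∀ B ∈ A, B ⊆ Δ.relevant p) ∧
      Δ.nf p {m | m ∈ Δ.Monomial p ∧ Δ.PView G m} =
        Δ.reduce p '' choiceValues (Δ.modulus p) (Δ.bound p) A := by
  obtain ⟨A, hA, hiff⟩ := exists_views_eq hΔ p G
  refine ⟨A, hA, ?_⟩
  have hred : ∀ m : S → ℕ, Δ.reduce p (fun v => m v % Δ.modulus p v) = Δ.reduce p m := by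
    intro m
    funext v
    unfold reduce modulus
    by_cases h1 : Δ.Periodic p v <;> by_cases h2 : Δ.Bounded p v <;> simp [h1, h2]
  -- In a monomial over the variables of `p`, an occurring variable of modulus `0` is bounded,
  -- because periods are at least 1. Absent variables satisfy the bound test since bounds are
  -- positive.
  have hbd : ∀ m ∈ Δ.Monomial p, (∀ s, Δ.Bounded p s → m s < Δ.bound p s) ↔
      ∀ b, Δ.modulus p b = 0 → m b ≠ 0 → m b < Δ.bound p b := by
    intro m hm
    constructor
    · intro h b h0 hb
      by_cases hbb : Δ.Bounded p b
      · exact h b hbb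
      · have hper := (hm b hb).resolve_left hbb
        obtain ⟨r, hr, -, hpos, -⟩ := period_mem hper
        rw [modulus, if_pos ⟨hper, hbb⟩] at h0
        omega
    · intro h s hs
      by_cases h0 : m s = 0
      · rw [h0]; exact Nat.succ_pos _
      · exact h s (by simp [modulus, hs]) h0
  ext m'
  constructor
  · rintro ⟨m, hm, hb, rfl⟩
    have hm1 := hm.1
    obtain ⟨z, hz, rfl⟩ := (hiff m).1 hm
    exact ⟨_, ⟨z, hz, (hbd _ hm1).1 hb, rfl⟩, hred _⟩
  · rintro ⟨_, ⟨z, hz, hb, rfl⟩, rfl⟩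
    have hm := (hiff _).2 ⟨z, hz, rfl⟩
    exact ⟨deg z, hm, (hbd _ hm.1).2 hb, hred _⟩

/-- A view contains at least one variable, which can be bounded or periodic only through a rule for
`p`. So nonterminals outside the rules, which the size of the grammar does not count, contribute
nothing. -/
theorem nf_views_eq_empty {p : P} (hp : Sum.inl p ∉ Δ.nonterminals) (G : Graph L) :
    Δ.nf p {m | m ∈ Δ.Monomial p ∧ Δ.PView G m} = ∅ := by
  classical
  refine Set.eq_empty_of_forall_notMem ?_
  rintro _ ⟨m, ⟨hm, x, l, -, -, rfl⟩, -⟩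
  apply hp
  have : ((x :: l).map Prod.fst).count x.1 ≠ 0 := by simp
  rcases hm x.1 (by convert this) with ⟨r, hr, k, hk, -⟩ | ⟨r, hr, ℓ, hℓ⟩
  · exact hk.1 ▸ head_mem hr
  · exact hℓ.1 ▸ head_mem hr

/-! ### Views of S-graphs -/

/-- Associativity preserves variables and size, so the derivation cannot be trivial: `s` heads a
rule. The remaining `q` is either `s` or was introduced by a rule. -/
theorem SView.mem {G : Graph L} {y : S × Option (P ⊕ S)} (h : Δ.SView G y) :
    y ∈ Δ.nonterminals.toRight ×ˢ Finset.insertNone Δ.nonterminals := by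
  obtain ⟨s, q⟩ := y
  have hhead : ∀ {w : Term L (P ⊕ S)}, Δ.Derives (Term.var (Sum.inr s)) w →
      w ≠ Term.var (Sum.inr s) → Sum.inr s ∈ Δ.nonterminals := fun hd hne => by
    obtain ⟨r, hr, -⟩ := hd.var.resolve_left hne
    exact head_mem hr
  rw [Finset.mem_product, Finset.mem_toRight, Finset.mem_insertNone]
  cases q with
  | none =>
    obtain ⟨t, ⟨w, hd, hw⟩, -⟩ := h
    refine ⟨hhead hd ?_, by simp⟩
    rintro rfl
    have := hw.vars_eq
    rw [Term.vars_lift] at this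
    simp [Term.vars] at this
  | some q =>
    obtain ⟨t, ⟨w, hd, hw⟩, -⟩ := h
    have hs := hhead hd (by
      rintro rfl
      have := hw.size_eq
      have := (t.lift : Term L (P ⊕ S)).one_le_size
      simp only [Term.size] at *
      omega)
    refine ⟨hs, ?_⟩
    intro a ha
    obtain rfl : q = a := by simpa using ha
    have hq : q ∈ w.vars := by rw [hw.vars_eq]; simp [Term.vars]
    rcases hd.vars_subset hq with h | h
    · have : q = Sum.inr s := by simpa [Term.vars] using h
      rwa [this]
    · exact h

/-! ### The number of profiles -/

/-- The estimate covers the profiles of all graphs, series-parallel or not, since a view itself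
supplies the needed ground terms. -/
theorem ncard_profiles_le [Finite P] (hΔ : Δ.SeqRules) {c N : ℕ} (hc : Δ.nonterminals.card ≤ c)
    (hN : ∀ r ∈ Δ.rules, r.2.size ≤ N) :
    (Set.range Δ.profile).Finite ∧ (Set.range Δ.profile).ncard ≤
      2 ^ (((c + 1) * (c * (N + 1) + c * (c * (c * (N + 1) + c * N ^ 2 + N) + N)) + 1) * c) +
      2 ^ (c * (c + 1)) := by
  classical
  have := Fintype.ofFinite P
  set e := (c + 1) * (c * (N + 1) + c * (c * (c * (N + 1) + c * N ^ 2 + N) + N)) + 1 with he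
  have hval := fun p => ncard_choiceValues_le (Δ.modulus p) (Δ.bound p) (R := Δ.relevant p)
    ((Δ.relevant_card_le p).trans hc) (modulus_le hN p) (bound_le hN p)
  -- Only the `p` occurring in the rules contribute a factor to the product, so the exponent is
  -- multiplied by `c` and not by the cardinality of `P`.
  let F : P → Finset (Set (S → ℕ)) := fun p => if Sum.inl p ∈ Δ.nonterminals then
    (hval p).1.toFinset.image (Set.image (Δ.reduce p)) else {∅}
  have hF : ∀ p, (F p).card ≤ if Sum.inl p ∈ Δ.nonterminals then 2 ^ e else 1 := by
    intro p
    simp only [F]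
    split_ifs
    · refine Finset.card_image_le.trans ?_
      rw [← Set.ncard_eq_toFinset_card _ (hval p).1]
      exact (hval p).2
    · simp
  let Y := Δ.nonterminals.toRight ×ˢ Finset.insertNone Δ.nonterminals
  let Z : Finset (Profile P S) :=
    (Fintype.piFinset F).image Sum.inl ∪ Y.powerset.image fun T : Finset _ => Sum.inr (T : Set _)
  have hsub : Set.range Δ.profile ⊆ (Z : Set (Profile P S)) := by
    rintro _ ⟨G, rfl⟩
    rw [Finset.mem_coe, Finset.mem_union, profile]
    split_ifs with h
    · left
      refine Finset.mem_image_of_mem _ (Fintype.mem_piFinset.2 fun p => ?_)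
      simp only [F]
      split_ifs with hp
      · obtain ⟨A, hA, heq⟩ := nf_views hΔ p G
        exact Finset.mem_image.2 ⟨_, (hval p).1.mem_toFinset.2 ⟨A, hA, rfl⟩, heq.symm⟩
      · rw [nf_views_eq_empty hp, Finset.mem_singleton]
    · right
      refine Finset.mem_image.2 ⟨Y.filter (Δ.SView G), Finset.mem_powerset.2
        (Finset.filter_subset _ _), ?_⟩
      congr 1
      ext y
      rw [Finset.coe_filter]
      exact and_iff_right_of_imp fun h : Δ.SView G y => h.mem
  refine ⟨Z.finite_toSet.subset hsub, ?_⟩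
  have h1 : (Fintype.piFinset F).card ≤ 2 ^ (e * c) := by
    rw [Fintype.card_piFinset]
    calc _ ≤ ∏ p, (if Sum.inl p ∈ Δ.nonterminals then 2 ^ e else 1) :=
          Finset.prod_le_prod' fun p _ => hF p
      _ = (2 ^ e) ^ (Finset.univ.filter fun p => Sum.inl p ∈ Δ.nonterminals).card := by
          rw [← Finset.prod_filter, Finset.prod_const]
      _ ≤ (2 ^ e) ^ c := by
          refine Nat.pow_le_pow_right (by positivity) (le_trans ?_ hc)
          refine Finset.card_le_card_of_injOn Sum.inl (fun p hp => ?_) Sum.inl_injective.injOn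
          simpa using hp
      _ = 2 ^ (e * c) := (pow_mul _ _ _).symm
  have h2 : Y.card ≤ c * (c + 1) := by
    rw [Finset.card_product, Finset.card_insertNone]
    exact Nat.mul_le_mul (Finset.card_toRight_le.trans hc) (by omega)
  calc _ ≤ (Z : Set (Profile P S)).ncard := Set.ncard_le_ncard hsub Z.finite_toSet
    _ = Z.card := Set.ncard_coe_finset _
    _ ≤ _ := Finset.card_union_le _ _
    _ ≤ _ := by
      refine Nat.add_le_add (Finset.card_image_le.trans h1) (Finset.card_image_le.trans ?_)
      rw [Finset.card_powerset]
      exact Nat.pow_le_pow_right (by norm_num) h2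

end Grammar

namespace Grammar

variable {L : Type u} {P : Type v} {S : Type w}

/-! ### The normal form and the alternative grammar -/

theorem IsRegular.seqRules {Γ : Grammar L (P ⊕ S)} (h : Γ.IsRegular) : Γ.SeqRules := by
  intro s t hr
  generalize hx : ((Sum.inr s : P ⊕ S), t) = r at hr
  cases h r hr with
  | A hA => rw [← hx] at hA; exact absurd hA.1 Sum.inr_ne_inl
  | B hB => rw [← hx] at hB; exact absurd hB.1 Sum.inr_ne_inl
  | C => exact Or.inr ⟨_, _, congrArg Prod.snd hx⟩
  | D => exact Or.inr ⟨_, _, congrArg Prod.snd hx⟩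
  | E => exact absurd (congrArg Prod.fst hx) Sum.inr_ne_inl
  | F => exact Or.inl ⟨_, congrArg Prod.snd hx⟩

theorem SeqRules.map {Γ : Grammar L (P ⊕ S)} (h : Γ.SeqRules) {M : Type*} (f : P ⊕ S → M) {s : S}
    {t : Term L (P ⊕ S)} (hr : (Sum.inr s, t) ∈ Γ.rules) :
    (∃ a, t.map f = Term.sym a) ∨ ∃ t₁ t₂, t.map f = Term.ser t₁ t₂ := by
  rcases h s t hr with ⟨a, rfl⟩ | ⟨t₁, t₂, rfl⟩
  · exact Or.inl ⟨a, rfl⟩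
  · exact Or.inr ⟨_, _, rfl⟩

theorem exists_of_old_eq_inr {T : Type*} {x : P ⊕ S} {y : S ⊕ T} (h : old x = Sum.inr y) :
    ∃ s, x = Sum.inr s := by
  cases x with
  | inl p => exact absurd h Sum.inl_ne_inr
  | inr s => exact ⟨s, rfl⟩

theorem SeqRules.normalize {Γ : Grammar L (P ⊕ S)} (h : Γ.SeqRules) : Γ.normalize.SeqRules := by
  rintro s t ((⟨r, hr, hrt⟩ | ⟨r, hrt⟩) | ⟨r, p, s', ℓ, t', -, hr, hrt⟩)
  · obtain ⟨x, t'⟩ := r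
    obtain ⟨h1, rfl⟩ := Prod.mk.inj hrt
    obtain ⟨s', rfl⟩ := exists_of_old_eq_inr h1
    exact h.map _ hr.1
  · obtain ⟨p, s', ℓ, hA⟩ := r.2.2
    have h1 := congrArg Prod.fst hrt
    dsimp only at h1
    rw [hA.1] at h1
    exact absurd h1 Sum.inl_ne_inr
  · rw [(Prod.mk.inj hrt).2]
    exact h.map _ hr

theorem SeqRules.alternative {Γ : Grammar L (P ⊕ S)} (h : Γ.SeqRules) :
    Γ.alternative.SeqRules := by
  rintro s t ((⟨r, hr, hrt⟩ | ⟨p, a, hr, hrt⟩) | ⟨a, hrt⟩)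
  · obtain ⟨x, t'⟩ := r
    obtain ⟨h1, rfl⟩ := Prod.mk.inj hrt
    obtain ⟨s', rfl⟩ := exists_of_old_eq_inr h1
    exact h.map _ hr.1
  · exact absurd (Prod.mk.inj hrt).1 Sum.inr_ne_inl
  · exact Or.inl ⟨a.1, (Prod.mk.inj hrt).2.symm⟩

theorem size_le_of_mem_normalize {Γ : Grammar L (P ⊕ S)} {N : ℕ}
    (hN : ∀ r ∈ Γ.rules, r.2.size ≤ N) : ∀ r ∈ Γ.normalize.rules, r.2.size ≤ N := by
  rintro _ ((⟨r, hr, rfl⟩ | ⟨r, rfl⟩) | ⟨r, p, s', ℓ, t', -, hr, rfl⟩)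
  · exact (Term.size_map _ _).trans_le (hN _ hr.1)
  · exact (Term.size_map _ _).trans_le (hN _ r.2.1)
  · exact (Term.size_map _ _).trans_le (hN _ hr)

theorem size_le_of_mem_alternative {Γ : Grammar L (P ⊕ S)} {N : ℕ} (hpos : 1 ≤ N)
    (hN : ∀ r ∈ Γ.rules, r.2.size ≤ N) : ∀ r ∈ Γ.alternative.rules, r.2.size ≤ N := by
  rintro _ ((⟨r, hr, rfl⟩ | ⟨p, a, hr, rfl⟩) | ⟨a, rfl⟩)
  · exact (Term.size_map _ _).trans_le (hN _ hr.1)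
  · exact hpos
  · exact hpos

theorem mem_image_old {Γ : Grammar L (P ⊕ S)} {T : Type*} {r : (P ⊕ S) × Term L (P ⊕ S)}
    (hr : r ∈ Γ.rules) {x : P ⊕ (S ⊕ T)} (hx : x = old r.1 ∨ x ∈ (r.2.map old).vars) :
    ∃ y ∈ Γ.nonterminals, old y = x := by
  rcases hx with rfl | hx
  · exact ⟨r.1, head_mem hr, rfl⟩
  · obtain ⟨y, hy, rfl⟩ := Term.mem_vars_map hx
    exact ⟨y, mem_nonterminals.2 ⟨r, hr, Or.inr hy⟩, rfl⟩

theorem card_le_of_old {T : Type*} [Finite T] {X : Finset (P ⊕ S)} {Y : Finset (P ⊕ (S ⊕ T))}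
    (h : ∀ y ∈ Y, (∃ x ∈ X, old x = y) ∨ ∃ t, y = Sum.inr (Sum.inr t)) :
    Y.card ≤ X.card + Nat.card T := by
  classical
  have := Fintype.ofFinite T
  have hsub : Y ⊆ X.image old ∪ Finset.univ.image fun t => Sum.inr (Sum.inr t) := by
    intro y hy
    rcases h y hy with ⟨x, hx, rfl⟩ | ⟨t, rfl⟩
    · exact Finset.mem_union_left _ (Finset.mem_image_of_mem _ hx)
    · exact Finset.mem_union_right _ (Finset.mem_image_of_mem _ (Finset.mem_univ t))
  refine (Finset.card_le_card hsub).trans ((Finset.card_union_le _ _).trans ?_)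
  refine Nat.add_le_add Finset.card_image_le (Finset.card_image_le.trans ?_)
  rw [Finset.card_univ, Nat.card_eq_fintype_card]

/-- There is one fresh nonterminal per rule of form (A), hence at most as many as there are rules.
-/
theorem card_nonterminals_normalize_le (Γ : Grammar L (P ⊕ S)) :
    Γ.normalize.nonterminals.card ≤ 2 * Γ.size := by
  have hA : Γ.RulesA ⊆ Γ.rules := fun r hr => hr.1
  have := (Γ.finite_rules.subset hA).to_subtype
  have h1 : Nat.card Γ.RulesA ≤ Γ.size :=
    (Set.ncard_le_ncard hA Γ.finite_rules).trans ncard_rules_le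
  have h2 : Γ.normalize.nonterminals.card ≤ Γ.nonterminals.card + Nat.card Γ.RulesA := by
    refine card_le_of_old fun y hy => ?_
    obtain ⟨r', hr', hy⟩ := mem_nonterminals.1 hy
    rcases hr' with (⟨r, hr, rfl⟩ | ⟨r, rfl⟩) | ⟨r, p, s, ℓ, t, -, hr, rfl⟩
    · exact Or.inl (mem_image_old hr.1 hy)
    · rcases hy with rfl | hy
      · exact Or.inl ⟨_, head_mem r.2.1, rfl⟩
      · obtain ⟨x, hx, rfl⟩ := Term.mem_vars_map hy
        cases x with
        | inl p => exact Or.inl ⟨_, mem_nonterminals.2 ⟨r.1, r.2.1, Or.inr hx⟩, rfl⟩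
        | inr s => exact Or.inr ⟨r, rfl⟩
    · rcases hy with rfl | hy
      · exact Or.inr ⟨r, rfl⟩
      · exact Or.inl (mem_image_old hr (Or.inr hy))
  have h3 := Γ.card_nonterminals_le
  omega

theorem card_nonterminals_alternative_le (Γ : Grammar L (P ⊕ S)) [Finite Γ.LabelsE] :
    Γ.alternative.nonterminals.card ≤ Γ.nonterminals.card + Nat.card Γ.LabelsE := by
  refine card_le_of_old fun y hy => ?_
  obtain ⟨r', hr', hy⟩ := mem_nonterminals.1 hy
  rcases hr' with (⟨r, hr, rfl⟩ | ⟨p, a, hr, rfl⟩) | ⟨a, rfl⟩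
  · exact Or.inl (mem_image_old hr.1 hy)
  · rcases hy with rfl | hy
    · exact Or.inl ⟨_, head_mem hr, rfl⟩
    · exact Or.inr ⟨a, by simpa [Term.vars] using hy⟩
  · rcases hy with rfl | hy
    · exact Or.inr ⟨a, rfl⟩
    · simp [Term.vars] at hy

/-- Lets the second batch of fresh nonterminals be counted by the size of the original grammar. -/
theorem labelsE_normalize_subset (Γ : Grammar L (P ⊕ S)) : Γ.normalize.LabelsE ⊆ Γ.LabelsE := by
  rintro a ⟨p, (⟨r, hr, hrt⟩ | ⟨r, hrt⟩) | ⟨r, p, s, ℓ, t, -, hr, hrt⟩⟩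
  · obtain ⟨x, t⟩ := r
    obtain ⟨h1, h2⟩ := Prod.mk.inj hrt
    cases x with
    | inr s => exact absurd h1 Sum.inr_ne_inl
    | inl q =>
      cases t with
      | sym b =>
        obtain rfl : b = a := Term.sym.inj h2
        exact ⟨q, hr.1⟩
      | _ => cases h2
  · obtain ⟨q, s, ℓ, hA⟩ := r.2.2
    have h2 := (Prod.mk.inj hrt).2
    have h3 := hA.2.2
    generalize r.1.2 = t at h2 h3
    cases t with
    | sym b => cases h3
    | _ => cases h2
  · exact absurd (Prod.mk.inj hrt).1 Sum.inl_ne_inr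

theorem ncard_labelsE_le (Γ : Grammar L (P ⊕ S)) :
    Γ.LabelsE.Finite ∧ Γ.LabelsE.ncard ≤ Γ.size := by
  have hinj : Set.InjOn (fun a : L => (Term.sym a : Term L (P ⊕ S))) Γ.LabelsE :=
    fun a _ b _ hab => Term.sym.inj hab
  have hfin := Γ.finite_rules.image Prod.snd
  have hmaps : ∀ a ∈ Γ.LabelsE, (Term.sym a : Term L (P ⊕ S)) ∈ Prod.snd '' Γ.rules := by
    rintro a ⟨p, hp⟩
    exact ⟨_, hp, rfl⟩
  exact ⟨Set.Finite.of_injOn hmaps hinj hfin, (Set.ncard_le_ncard_of_injOn _ hmaps hinj hfin).trans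
    ((Set.ncard_image_le Γ.finite_rules).trans ncard_rules_le)⟩

theorem card_nonterminals_recognizer_le (Γ : Grammar L (P ⊕ S)) :
    Γ.normalize.alternative.nonterminals.card ≤ 3 * Γ.size := by
  obtain ⟨hfin, hcard⟩ := Γ.ncard_labelsE_le
  have hsub := Γ.labelsE_normalize_subset
  have := (hfin.subset hsub).to_subtype
  have h1 := Γ.normalize.card_nonterminals_alternative_le
  have h2 : Nat.card Γ.normalize.LabelsE ≤ Γ.size := (Set.ncard_le_ncard hsub hfin).trans hcard
  have h3 := Γ.card_nonterminals_normalize_le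
  omega

/-- Here `c = 3 * g` and `N = g`. The larger exponent has degree 7 in `g`; bounding all monomials by
`g ^ 9` and adding up the coefficients suffices, and one unit of the constant absorbs the sum of the
two powers. -/
theorem profile_count_le {g : ℕ} (hg : 1 ≤ g) :
    2 ^ (((3 * g + 1) * (3 * g * (g + 1) +
        3 * g * (3 * g * (3 * g * (g + 1) + 3 * g * g ^ 2 + g) + g)) + 1) * (3 * g)) +
      2 ^ (3 * g * (3 * g + 1)) ≤ 2 ^ (2000 * g ^ 9) := by
  have hpow : ∀ i ≤ 9, g ^ i ≤ g ^ 9 := fun i h => Nat.pow_le_pow_right hg h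
  have h0 := hpow 0 (by norm_num)
  have h1 := hpow 1 (by norm_num)
  have h2 := hpow 2 (by norm_num)
  have h3 := hpow 3 (by norm_num)
  have h4 := hpow 4 (by norm_num)
  have h5 := hpow 5 (by norm_num)
  have h6 := hpow 6 (by norm_num)
  have h7 := hpow 7 (by norm_num)
  have e1 : ((3 * g + 1) * (3 * g * (g + 1) +
      3 * g * (3 * g * (3 * g * (g + 1) + 3 * g * g ^ 2 + g) + g)) + 1) * (3 * g) ≤
      1999 * g ^ 9 := by
    ring_nf at *
    omega
  have e2 : 3 * g * (3 * g + 1) ≤ 1999 * g ^ 9 := by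
    ring_nf at *
    omega
  calc _ ≤ 2 ^ (1999 * g ^ 9) + 2 ^ (1999 * g ^ 9) :=
        Nat.add_le_add (Nat.pow_le_pow_right two_pos e1) (Nat.pow_le_pow_right two_pos e2)
    _ = 2 ^ (1999 * g ^ 9 + 1) := by rw [pow_succ]; ring
    _ ≤ _ := Nat.pow_le_pow_right two_pos (by rw [pow_zero] at h0; omega)

theorem domain_subset_range (Γ : Grammar L (P ⊕ S)) :
    Γ.profileAlgebra.domain ⊆ Set.range Γ.profile := by
  rintro _ ⟨G, -, rfl⟩
  exact ⟨G, rfl⟩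

end Grammar

end SP

theorem mainTheorem3 :
    ∃ C : ℕ, ∀ (L P S : Type*) [Finite L] [Finite P] [Finite S] (Γ : SP.Grammar L (P ⊕ S)),
      Γ.IsRegular → 0 < Γ.size →
        Γ.recognizer.domain.Finite ∧ Γ.recognizer.domain.ncard ≤ 2 ^ (C * Γ.size ^ 9) := by
  refine ⟨2000, fun L P S _ _ _ Γ hreg hpos => ?_⟩
  obtain ⟨hfin, hcard⟩ := SP.Grammar.ncard_profiles_le hreg.seqRules.normalize.alternative
    Γ.card_nonterminals_recognizer_le
    (SP.Grammar.size_le_of_mem_alternative hpos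
      (SP.Grammar.size_le_of_mem_normalize fun r hr => SP.Grammar.size_le_of_mem hr))
  have hsub := Γ.normalize.alternative.domain_subset_range
  exact ⟨hfin.subset hsub, (Set.ncard_le_ncard hsub hfin).trans
    (hcard.trans (SP.Grammar.profile_count_le hpos))⟩
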